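/- Let $X=\{X_1,\dots,X_n\}$ be binary random variables with joint distribution $\Pr$ on $\{0,1\}^n$. A decomposition of $X$ is a partition of $X$ into nonempty blocks $\mathbf X_1,\dots,\mathbf X_k$, the variables of each block being listed in a fixed order; its width is $\max_i|\mathbf X_i|$. It is exchangeable if all blocks have the same size and $\Pr(\mathbf X_1=\mathbf x_1,\dots,\mathbf X_k=\mathbf x_k)=\Pr(\mathbf X_1=\mathbf x_{\pi(1)},\dots,\mathbf X_k=\mathbf x_{\pi(k)})$ for all bit strings $\mathbf x_1,\dots,\mathbf x_k$ of that size and all permutations $\pi$ of $\{1,\dots,k\}$. A model consists of a number $n$, a distribution $\Pr$ of $n$ binary variables, a finite description (a finite list of finite trees with numbers at the leaves) through which algorithms access $\Pr$, and a decomposition of the variables. Theorem. Fix $w\in\mathbb N$ and let $\mathcal C$ be any class of models in each of which the decomposition is exchangeable and of width at most $w$. Suppose that there are an algorithm and a polynomial $p$ such that, for every model in $\mathcal C$ with $n$ variables and every full assignment $\mathbf x\in\{0,1\}^n$, the algorithm computes $\Pr(\mathbf x)$ from the description and $\mathbf x$ in time at most $p(n)$. Then there are algorithms and polynomials $q,r$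 such that, for every model in $\mathcal C$ with $n$ variables and every assignment $\mathbf e$ to a subset $\mathbf E\subseteq X$, given the description, the decomposition and $\mathbf e$, 1. (MPE inference) the first algorithm computes, in time at most $q(n)$, a full assignment that extends $\mathbf e$ and has maximal probability among all full assignments extending $\mathbf e$; 2. (marginal inference) the second algorithm computes, in time at most $r(n)$, the marginal probability $\Pr(\mathbf e)=\sum_{\mathbf x\text{ extends }\mathbf e}\Pr(\mathbf x)$. Algorithms are while-programs that manipulate binary trees with numbers at the leaves, using pairing, projections, the four arithmetic operations and comparison of numbers, with natural number literals as their only numerical constants. The theorem holds in each of two cost models: (i) probabilities and numbers in descriptions are rational, and handling a number costs its bit length; (ii) they are real, and exact arithmetic operations and comparisons cost one unit. In both, every other elementary operation has unit cost. -/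

import Mathlib

namespace Exch

/-! ## The machine model: while-programs over trees with numbers at the leaves -/

/-- The values that a program manipulates: binary trees whose leaves are `nil` or numbers of `𝕜`.
Values are immutable, so moving a tree from one variable to another moves a pointer. -/
inductive Datum (𝕜 : Type) : Type where
  | nil : Datum 𝕜
  | num (a : 𝕜) : Datum 𝕜
  | cons (u v : Datum 𝕜) : Datum 𝕜

/-- Expressions. A program is a finite object: it may contain natural number literals, but no
other constant of `𝕜`. -/
inductive Expr : Type where
  | var (i : ℕ) : Expr
  | nil : Expr
  | lit (m : ℕ) : Expr
  | cons (e f : Expr) : Expr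
  | fst (e : Expr) : Expr
  | snd (e : Expr) : Expr
  | add (e f : Expr) : Expr
  | sub (e f : Expr) : Expr
  | mul (e f : Expr) : Expr
  | div (e f : Expr) : Expr

/-- Conditions for branching. They inspect only the root of a tree. -/
inductive Test : Type where
  | isCons (e : Expr) : Test
  | isNum (e : Expr) : Test
  | lt (e f : Expr) : Test

/-- While-programs. -/
inductive Program : Type where
  | skip : Program
  | assign (i : ℕ) (e : Expr) : Program
  | seq (P Q : Program) : Program
  | ite (b : Test) (P Q : Program) : Program
  | while (b : Test) (P : Program) : Program

/-- The contents of the variables. -/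
abbrev Store (𝕜 : Type) : Type := ℕ → Datum 𝕜

section Semantics

variable {𝕜 : Type} [Field 𝕜] [LinearOrder 𝕜]

/-- First component of a pair (`nil` on a leaf). -/
def Datum.fst : Datum 𝕜 → Datum 𝕜
  | .cons u _ => u
  | _ => .nil

/-- Second component of a pair (`nil` on a leaf). -/
def Datum.snd : Datum 𝕜 → Datum 𝕜
  | .cons _ v => v
  | _ => .nil

/-- Apply an arithmetic operation to two numbers (`nil` if an argument is not a number). -/
def Datum.arith (op : 𝕜 → 𝕜 → 𝕜) : Datum 𝕜 → Datum 𝕜 → Datum 𝕜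
  | .num a, .num b => .num (op a b)
  | _, _ => .nil

/-- Value of an expression. -/
def Expr.eval (s : Store 𝕜) : Expr → Datum 𝕜
  | .var i => s i
  | .nil => .nil
  | .lit m => .num (m : 𝕜)
  | .cons e f => .cons (e.eval s) (f.eval s)
  | .fst e => (e.eval s).fst
  | .snd e => (e.eval s).snd
  | .add e f => Datum.arith (· + ·) (e.eval s) (f.eval s)
  | .sub e f => Datum.arith (· - ·) (e.eval s) (f.eval s)
  | .mul e f => Datum.arith (· * ·) (e.eval s) (f.eval s)
  | .div e f => Datum.arith (· / ·) (e.eval s) (f.eval s)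

/-- The cost of handling a value: that of the number for a number, one for a pointer. -/
def Datum.rootCost (size : 𝕜 → ℕ) : Datum 𝕜 → ℕ
  | .num a => size a
  | _ => 1

/-- Time to evaluate an expression: every operation is charged one, plus the cost of its result
(and of its operands, through the recursion). -/
def Expr.cost (size : 𝕜 → ℕ) (s : Store 𝕜) : Expr → ℕ
  | .var i => 1 + (s i).rootCost size
  | .nil => 1 + (Datum.nil : Datum 𝕜).rootCost size
  | .lit m => 1 + (Datum.num (m : 𝕜)).rootCost size
  | .cons e f => 1 + e.cost size s + f.cost size s + ((Expr.cons e f).eval s).rootCost size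
  | .fst e => 1 + e.cost size s + ((Expr.fst e).eval s).rootCost size
  | .snd e => 1 + e.cost size s + ((Expr.snd e).eval s).rootCost size
  | .add e f => 1 + e.cost size s + f.cost size s + ((Expr.add e f).eval s).rootCost size
  | .sub e f => 1 + e.cost size s + f.cost size s + ((Expr.sub e f).eval s).rootCost size
  | .mul e f => 1 + e.cost size s + f.cost size s + ((Expr.mul e f).eval s).rootCost size
  | .div e f => 1 + e.cost size s + f.cost size s + ((Expr.div e f).eval s).rootCost size

/-- Truth of a condition. -/
def Test.Holds (s : Store 𝕜) : Test → Prop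
  | .isCons e => ∃ u v, e.eval s = .cons u v
  | .isNum e => ∃ a, e.eval s = .num a
  | .lt e f => ∃ a b, e.eval s = .num a ∧ f.eval s = .num b ∧ a < b

/-- Time to check a condition. -/
def Test.cost (size : 𝕜 → ℕ) (s : Store 𝕜) : Test → ℕ
  | .isCons e => 1 + e.cost size s
  | .isNum e => 1 + e.cost size s
  | .lt e f => 1 + e.cost size s + f.cost size s

/-- `Exec size P s t s'`: started on the store `s`, the program `P` halts after time `t`
with the store `s'`. -/
inductive Exec (size : 𝕜 → ℕ) : Program → Store 𝕜 → ℕ → Store 𝕜 → Prop where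
  | skip (s : Store 𝕜) : Exec size .skip s 1 s
  | assign (i : ℕ) (e : Expr) (s : Store 𝕜) :
      Exec size (.assign i e) s (1 + e.cost size s) (Function.update s i (e.eval s))
  | seq {P Q : Program} {s₁ s₂ s₃ : Store 𝕜} {t u : ℕ} :
      Exec size P s₁ t s₂ → Exec size Q s₂ u s₃ → Exec size (.seq P Q) s₁ (t + u) s₃
  | iteTrue {b : Test} {P Q : Program} {s s' : Store 𝕜} {t : ℕ} :
      b.Holds s → Exec size P s t s' → Exec size (.ite b P Q) s (b.cost size s + t) s'
  | iteFalse {b : Test} {P Q : Program} {s s' : Store 𝕜} {t : ℕ} :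
      ¬ b.Holds s → Exec size Q s t s' → Exec size (.ite b P Q) s (b.cost size s + t) s'
  | whileTrue {b : Test} {P : Program} {s₁ s₂ s₃ : Store 𝕜} {t u : ℕ} :
      b.Holds s₁ → Exec size P s₁ t s₂ → Exec size (.while b P) s₂ u s₃ →
        Exec size (.while b P) s₁ (b.cost size s₁ + t + u) s₃
  | whileFalse {b : Test} {P : Program} {s : Store 𝕜} :
      ¬ b.Holds s → Exec size (.while b P) s (b.cost size s) s

/-- On the input `inp` (variable `0`; all other variables are `nil`) the program `P` halts after
time `t` with the output `out` (again in variable `0`). -/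
def Runs (size : 𝕜 → ℕ) (P : Program) (inp : Datum 𝕜) (t : ℕ) (out : Datum 𝕜) : Prop :=
  ∃ s : Store 𝕜, Exec size P (Function.update (fun _ => Datum.nil) 0 inp) t s ∧ s 0 = out

end Semantics

/-- Every number costs one: exact arithmetic at unit cost. -/
def unitSize (_ : ℝ) : ℕ := 1

/-- Bit length of a rational number, i.e. of its reduced numerator and denominator. -/
def bitSize (q : ℚ) : ℕ := q.num.natAbs.size + q.den.size

/-! ## Distributions, assignments and decompositions -/

/-- `e : Fin n → Option Bool` is a partial assignment (`none`: not assigned); the full assignment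
`x` extends it. -/
def Extends {n : ℕ} (x : Fin n → Bool) (e : Fin n → Option Bool) : Prop :=
  ∀ v : Fin n, ∀ b : Bool, e v = some b → x v = b

instance {n : ℕ} (x : Fin n → Bool) (e : Fin n → Option Bool) : Decidable (Extends x e) := by
  unfold Extends
  infer_instance

/-- A joint distribution of `n` binary random variables, with probabilities in `𝕜`. -/
structure Distribution (𝕜 : Type) [Field 𝕜] [LinearOrder 𝕜] (n : ℕ) where
  prob : (Fin n → Bool) → 𝕜
  nonneg : ∀ x, 0 ≤ prob x
  sum_eq_one : ∑ x, prob x = 1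

/-- The marginal probability of the partial assignment `e`. -/
def Distribution.marginal {𝕜 : Type} [Field 𝕜] [LinearOrder 𝕜] {n : ℕ}
    (μ : Distribution 𝕜 n) (e : Fin n → Option Bool) : 𝕜 :=
  ∑ x : Fin n → Bool with Extends x e, μ.prob x

/-- `x` is a most probable completion of the partial assignment `e`. -/
def Distribution.IsMPE {𝕜 : Type} [Field 𝕜] [LinearOrder 𝕜] {n : ℕ}
    (μ : Distribution 𝕜 n) (e : Fin n → Option Bool) (x : Fin n → Bool) : Prop :=
  Extends x e ∧ ∀ y : Fin n → Bool, Extends y e → μ.prob y ≤ μ.prob x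

/-- A partition of the variables into `k` nonempty blocks. Each block is listed in a definite
order, so that its assignments are bit strings. -/
structure Decomposition (n : ℕ) where
  k : ℕ
  block : Fin k → List (Fin n)
  block_ne_nil : ∀ i, block i ≠ []
  nodup : ∀ i, (block i).Nodup
  existsUnique_mem : ∀ v : Fin n, ∃! i, v ∈ block i

/-- The width: the largest number of variables in a block. -/
def Decomposition.width {n : ℕ} (D : Decomposition n) : ℕ :=
  Finset.univ.sup fun i => (D.block i).length

/-- All blocks have the same size, and permuting the bit strings assigned to the blocks does not
change the probability: if `x'` assigns to the block `i` the bit string that `x` assigns to the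
block `π i`, then `x'` and `x` are equally probable. -/
def Decomposition.IsExchangeable {𝕜 : Type} [Field 𝕜] [LinearOrder 𝕜] {n : ℕ}
    (D : Decomposition n) (μ : Distribution 𝕜 n) : Prop :=
  (∀ i j, (D.block i).length = (D.block j).length) ∧
    ∀ (π : Equiv.Perm (Fin D.k)) (x x' : Fin n → Bool),
      (∀ i, (D.block i).map x' = (D.block (π i)).map x) → μ.prob x' = μ.prob x

/-! ## Inference problems -/

/-- A probabilistic model: a distribution, a finite description of it (any finite list of trees;
it is what programs get to see of the distribution), and a decomposition of its variables. -/
structure Model (𝕜 : Type) [Field 𝕜] [LinearOrder 𝕜] where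
  n : ℕ
  dist : Distribution 𝕜 n
  descr : List (Datum 𝕜)
  decomp : Decomposition n

section Encoding

variable {𝕜 : Type} [Field 𝕜] [LinearOrder 𝕜]

/-- A list as a tree. -/
def encodeList : List (Datum 𝕜) → Datum 𝕜
  | [] => .nil
  | u :: l => .cons u (encodeList l)

/-- Bits are the numbers `0` and `1`. -/
def encodeBit (b : Bool) : Datum 𝕜 := .num (if b then 1 else 0)

/-- Full assignments are lists of bits. -/
def encodeAssignment {n : ℕ} (x : Fin n → Bool) : Datum 𝕜 :=
  encodeList (List.ofFn fun v => encodeBit (x v))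

/-- Partial assignments are lists with `nil` for the unassigned variables. -/
def encodePartial {n : ℕ} (e : Fin n → Option Bool) : Datum 𝕜 :=
  encodeList (List.ofFn fun v => (e v).elim .nil encodeBit)

/-- Decompositions are lists of lists of variable indices. -/
def encodeDecomposition {n : ℕ} (D : Decomposition n) : Datum 𝕜 :=
  encodeList (List.ofFn fun i =>
    encodeList ((D.block i).map fun v => Datum.num (((v : ℕ) : 𝕜))))

/-- The input for evaluating the probability of `x`. -/
def Model.evalInput (M : Model 𝕜) (x : Fin M.n → Bool) : Datum 𝕜 :=
  .cons (encodeList M.descr) (encodeAssignment x)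

/-- The input for inference with the evidence `e`; the decomposition is given. -/
def Model.inferenceInput (M : Model 𝕜) (e : Fin M.n → Option Bool) : Datum 𝕜 :=
  .cons (encodeList M.descr) (.cons (encodeDecomposition M.decomp) (encodePartial e))

/-- The probabilities of full assignments are computable in time polynomial in the number of
variables, uniformly over the models of the class `C`. -/
def EvaluationInPolyTime (size : 𝕜 → ℕ) (C : Set (Model 𝕜)) : Prop :=
  ∃ (P : Program) (p : Polynomial ℕ), ∀ M ∈ C, ∀ x : Fin M.n → Bool,
    ∃ t ≤ p.eval M.n, Runs size P (M.evalInput x) t (.num (M.dist.prob x))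

/-- MPE inference on the models of `C` takes time polynomial in the number of variables. -/
def MPEInPolyTime (size : 𝕜 → ℕ) (C : Set (Model 𝕜)) : Prop :=
  ∃ (P : Program) (p : Polynomial ℕ), ∀ M ∈ C, ∀ e : Fin M.n → Option Bool,
    ∃ t ≤ p.eval M.n, ∃ x : Fin M.n → Bool, M.dist.IsMPE e x ∧
      Runs size P (M.inferenceInput e) t (encodeAssignment x)

/-- Marginal inference on the models of `C` takes time polynomial in the number of variables. -/
def MarginalInPolyTime (size : 𝕜 → ℕ) (C : Set (Model 𝕜)) : Prop :=
  ∃ (P : Program) (p : Polynomial ℕ), ∀ M ∈ C, ∀ e : Fin M.n → Option Bool,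
    ∃ t ≤ p.eval M.n, Runs size P (M.inferenceInput e) t (.num (M.dist.marginal e))

end Encoding

end Exch

/-!
Both inference problems are solved by dynamic programming over the blocks. The bit strings of the
blocks enter the probability of a full assignment `x` only through the number of times that each
string occurs. These numbers are the digits of a single natural number, the key of `x`
(`fullKey`): with a base `B` larger than the number of blocks, the key is the sum of `B ^ a` over
the blocks, where `a` is the number with the binary digits that `x` assigns to the block. Full
assignments with equal keys are equally probable (`Decomposition.IsExchangeable.prob_eq`). If the
width is at most `w`, then a key is at most `k * B ^ 2 ^ w` for `k` blocks, so that only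
polynomially many keys occur.

The algorithm maintains a table with one entry per key: a representative assignment of the
variables processed so far that is consistent with the evidence, and the number of such
assignments with this key. To process a block, its variables are assigned one after the other
in all possible ways, which multiplies the length of the table by at most `2 ^ w`; then the keys are
updated and entries with equal keys are united. Correctness (`table_spec`) rests on an invariant:
for a function `G` of the full assignment that factors through the key, the sum of `G` over all
extensions of an entry, weighted with the count of the entry and summed over the table, never
changes. With `G` the probability this expresses the marginal as a sum over the final table;
with `G` the indicator function of a key it shows that every key that is possible under the
evidence is represented, so that a most probable completion is found in the table.

Running times are controlled by the predicate `PolyTime size N c f`: one program computes `f i`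
from `c i`, for all indices `i`, in time polynomial in `N i`. It is closed under pairing,
composition, branching, bounded arithmetic and loops over lists (`PolyTime.foldl`), where the
body of a loop only has to be analysed on the states that actually occur. Programs are composed by
means of a stack in variable `1`, and the given evaluation program is made a subroutine by renaming
its variables (`PolyTime.of_runs`). The two cost models share one proof: all that is used of the
size of numbers is `IsArithmeticSize`. For bit lengths, it matters that the bound for a sum of many
rationals is linear in the sum of their sizes, which holds as the denominator of the sum divides
the product of the denominators; and that the evaluation program has no time to write down
probabilities of superpolynomial length (`Exec.rootCost_le`).
-/

namespace Exch

/-! ### Polynomial bounds and the calling convention -/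

section PolyBounded

variable {ι κ : Type*} {N f g : ι → ℕ}

/-- The quantity `f i` is bounded by a polynomial in the size `N i`, uniformly in `i`. -/
def PolyBounded (N f : ι → ℕ) : Prop :=
  ∃ p : Polynomial ℕ, ∀ i, f i ≤ p.eval (N i)

theorem PolyBounded.mono (hf : PolyBounded N f) (h : ∀ i, g i ≤ f i) : PolyBounded N g := by
  obtain ⟨p, hp⟩ := hf
  exact ⟨p, fun i => (h i).trans (hp i)⟩

theorem PolyBounded.const (m : ℕ) : PolyBounded N fun _ => m :=
  ⟨Polynomial.C m, fun i => by simp⟩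

theorem PolyBounded.self : PolyBounded N N :=
  ⟨Polynomial.X, fun i => by simp⟩

theorem PolyBounded.add (hf : PolyBounded N f) (hg : PolyBounded N g) :
    PolyBounded N fun i => f i + g i := by
  obtain ⟨p, hp⟩ := hf
  obtain ⟨q, hq⟩ := hg
  exact ⟨p + q, fun i => by simpa using add_le_add (hp i) (hq i)⟩

theorem PolyBounded.mul (hf : PolyBounded N f) (hg : PolyBounded N g) :
    PolyBounded N fun i => f i * g i := by
  obtain ⟨p, hp⟩ := hf
  obtain ⟨q, hq⟩ := hg
  exact ⟨p * q, fun i => by simpa using Nat.mul_le_mul (hp i) (hq i)⟩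

theorem PolyBounded.pow (hf : PolyBounded N f) (m : ℕ) : PolyBounded N fun i => f i ^ m := by
  obtain ⟨p, hp⟩ := hf
  exact ⟨p ^ m, fun i => by simpa using Nat.pow_le_pow_left (hp i) m⟩

theorem PolyBounded.comap (hf : PolyBounded N f) (φ : κ → ι) :
    PolyBounded (fun k => N (φ k)) fun k => f (φ k) := by
  obtain ⟨p, hp⟩ := hf
  exact ⟨p, fun k => hp (φ k)⟩

end PolyBounded

section Transforms

variable {𝕜 : Type} {size : 𝕜 → ℕ}

@[simp]
theorem Datum.rootCost_nil : (Datum.nil : Datum 𝕜).rootCost size = 1 := rfl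

@[simp]
theorem Datum.rootCost_num (a : 𝕜) : (Datum.num a).rootCost size = size a := rfl

@[simp]
theorem Datum.rootCost_cons (u v : Datum 𝕜) : (Datum.cons u v).rootCost size = 1 := rfl

variable [Field 𝕜] [LinearOrder 𝕜]

/-- The program `P` turns the content `u` of variable `0` into `v` within time `t`. Variable `1`
holds a stack, which is never a number and which `P` restores; `P` may start with arbitrary junk
in the other variables and may leave junk there. -/
def Transforms (size : 𝕜 → ℕ) (P : Program) (u : Datum 𝕜) (t : ℕ) (v : Datum 𝕜) : Prop :=
  ∀ s : Store 𝕜, s 0 = u → (s 1).rootCost size = 1 →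
    ∃ t' ≤ t, ∃ s' : Store 𝕜, Exec size P s t' s' ∧ s' 0 = v ∧ s' 1 = s 1

variable {P Q : Program} {u v w : Datum 𝕜} {t t' : ℕ}

theorem Transforms.mono (h : Transforms size P u t v) (ht : t ≤ t') : Transforms size P u t' v := by
  intro s h0 h1
  obtain ⟨a, ha, s', h⟩ := h s h0 h1
  exact ⟨a, ha.trans ht, s', h⟩

theorem Transforms.runs (h : Transforms size P u t v) : ∃ t' ≤ t, Runs size P u t' v := by
  obtain ⟨a, ha, s', h, h0, -⟩ :=
    h (Function.update (fun _ => Datum.nil) 0 u) (by simp) (by simp)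
  exact ⟨a, ha, s', h, h0⟩

theorem Transforms.assign {e : Expr}
    (h : ∀ s : Store 𝕜, s 0 = u → e.eval s = v ∧ e.cost size s ≤ t) :
    Transforms size (.assign 0 e) u (1 + t) v := by
  intro s h0 _
  exact ⟨_, by have := (h s h0).2; omega, _, Exec.assign 0 e s, by simp [(h s h0).1], by simp⟩

theorem Transforms.seq (hP : Transforms size P u t v) (hQ : Transforms size Q v t' w) :
    Transforms size (.seq P Q) u (t + t') w := by
  intro s h0 h1
  obtain ⟨a, ha, s₁, e₁, h₁, k₁⟩ := hP s h0 h1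
  obtain ⟨b, hb, s₂, e₂, h₂, k₂⟩ := hQ s₁ h₁ (by rw [k₁, h1])
  exact ⟨a + b, by omega, s₂, e₁.seq e₂, h₂, k₂.trans k₁⟩

/-- Run `P` and `Q` on the same input and pair the results. The input and the first result wait
on the stack. -/
def Program.pair (P Q : Program) : Program :=
  .seq (.assign 1 (.cons (.var 0) (.var 1))) <|
  .seq P <|
  .seq (.assign 1 (.cons (.var 0) (.var 1))) <|
  .seq (.assign 0 (.fst (.snd (.var 1)))) <|
  .seq Q <|
  .seq (.assign 0 (.cons (.fst (.var 1)) (.var 0))) <|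
  .assign 1 (.snd (.snd (.var 1)))

theorem Transforms.pair (hP : Transforms size P u t v) (hQ : Transforms size Q u t' w) :
    Transforms size (P.pair Q) u
      (t + t' + 40 + 2 * u.rootCost size + 2 * v.rootCost size + w.rootCost size)
      (.cons v w) := by
  intro s h0 h1
  obtain ⟨a, ha, s₁, e₁, h₁, k₁⟩ := hP (Function.update s 1 (.cons u (s 1))) (by simp [h0])
    (by simp)
  obtain ⟨b, hb, s₂, e₂, h₂, k₂⟩ := hQ
    (Function.update (Function.update s₁ 1 (.cons v (s₁ 1))) 0 u) (by simp)
    (by simp)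
  simp only [Function.update_self, ne_eq, one_ne_zero, not_false_eq_true,
    Function.update_of_ne] at k₁ k₂
  rw [k₁] at e₂ k₂
  have a₁ := Exec.assign (size := size) 1 (.cons (.var 0) (.var 1)) s
  have a₂ := Exec.assign (size := size) 1 (.cons (.var 0) (.var 1)) s₁
  have a₃ := Exec.assign (size := size) 0 (.fst (.snd (.var 1)))
    (Function.update s₁ 1 (.cons v (s₁ 1)))
  have a₄ := Exec.assign (size := size) 0 (.cons (.fst (.var 1)) (.var 0)) s₂
  have a₅ := Exec.assign (size := size) 1 (.snd (.snd (.var 1)))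
    (Function.update s₂ 0 (.cons v w))
  simp only [Expr.eval, Expr.cost, h0, h1, h₁, h₂, k₁, k₂, Datum.fst, Datum.snd,
    Function.update_self, Datum.rootCost_cons, ne_eq, one_ne_zero, not_false_eq_true,
    Function.update_of_ne] at a₁ a₂ a₃ a₄ a₅
  exact ⟨_, by omega, _, a₁.seq (e₁.seq (a₂.seq (a₃.seq (e₂.seq (a₄.seq a₅))))), by simp, by simp⟩

theorem Transforms.ite_pos {b : Test} (hb : ∀ s : Store 𝕜, s 0 = u → b.Holds s ∧ b.cost size s ≤ t)
    (hP : Transforms size P u t' v) : Transforms size (.ite b P Q) u (t + t') v := by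
  intro s h0 h1
  obtain ⟨a, ha, s₁, e₁, h₁, k₁⟩ := hP s h0 h1
  obtain ⟨hb, hc⟩ := hb s h0
  exact ⟨_, by omega, s₁, e₁.iteTrue hb, h₁, k₁⟩

theorem Transforms.ite_neg {b : Test}
    (hb : ∀ s : Store 𝕜, s 0 = u → ¬ b.Holds s ∧ b.cost size s ≤ t)
    (hQ : Transforms size Q u t' v) : Transforms size (.ite b P Q) u (t + t') v := by
  intro s h0 h1
  obtain ⟨a, ha, s₁, e₁, h₁, k₁⟩ := hQ s h0 h1
  obtain ⟨hb, hc⟩ := hb s h0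
  exact ⟨_, by omega, s₁, e₁.iteFalse hb, h₁, k₁⟩

theorem Transforms.while {b : Test} (m : ℕ) (st : ℕ → Datum 𝕜)
    (hb : ∀ j ≤ m, ∀ s : Store 𝕜, s 0 = st j → (b.Holds s ↔ j < m) ∧ b.cost size s ≤ t)
    (hP : ∀ j < m, Transforms size P (st j) t' (st (j + 1))) :
    Transforms size (.while b P) (st 0) (m * (t + t') + t) (st m) := by
  induction m generalizing st with
  | zero =>
    intro s h0 _
    obtain ⟨h, hc⟩ := hb 0 le_rfl s h0
    exact ⟨_, by omega, s, .whileFalse (by simp [h]), h0, rfl⟩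
  | succ m ih =>
    intro s h0 h1
    obtain ⟨h, hc⟩ := hb 0 (by omega) s h0
    obtain ⟨a, ha, s₁, e₁, h₁, k₁⟩ := hP 0 (by omega) s h0 h1
    obtain ⟨a', ha', s₂, e₂, h₂, k₂⟩ := ih (fun j => st (j + 1))
      (fun j hj s hs => by simpa using hb (j + 1) (by omega) s hs)
      (fun j hj => hP (j + 1) (by omega)) s₁ h₁ (by rw [k₁, h1])
    refine ⟨_, ?_, s₂, .whileTrue (h.2 (by omega)) e₁ e₂, h₂, k₂.trans k₁⟩
    rw [Nat.succ_mul]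
    omega

end Transforms

/-! ### Transformations in uniform polynomial time -/

section PolyTime

variable {𝕜 : Type} {size : 𝕜 → ℕ} {ι κ : Type*} {N : ι → ℕ} {c d f g : ι → Datum 𝕜}

/-- The cost of handling the roots of the data `f i` is bounded by a polynomial in `N i`. -/
def RootBounded (size : 𝕜 → ℕ) (N : ι → ℕ) (f : ι → Datum 𝕜) : Prop :=
  PolyBounded N fun i => (f i).rootCost size

theorem RootBounded.cons : RootBounded size N fun i => .cons (f i) (g i) :=
  (PolyBounded.const 1).mono fun _ => le_rfl

theorem RootBounded.nil : RootBounded size N fun _ => .nil :=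
  (PolyBounded.const 1).mono fun _ => le_rfl

theorem RootBounded.comap (hf : RootBounded size N f) (φ : κ → ι) :
    RootBounded size (fun k => N (φ k)) fun k => f (φ k) :=
  PolyBounded.comap hf φ

theorem rootCost_encodeList (l : List (Datum 𝕜)) : (encodeList l).rootCost size = 1 := by
  cases l <;> rfl

theorem RootBounded.encodeList (l : ι → List (Datum 𝕜)) :
    RootBounded size N fun i => encodeList (l i) :=
  (PolyBounded.const 1).mono fun i => (rootCost_encodeList (l i)).le

theorem RootBounded.of_cases {p : ι → Prop}
    (hp : RootBounded size (fun i : {i // p i} => N i) fun i => f i)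
    (hn : RootBounded size (fun i : {i // ¬ p i} => N i) fun i => f i) : RootBounded size N f := by
  classical
  obtain ⟨q, hq⟩ := hp
  obtain ⟨r, hr⟩ := hn
  refine ⟨q + r, fun i => ?_⟩
  rw [Polynomial.eval_add]
  by_cases h : p i
  · have := hq ⟨i, h⟩
    exact this.trans (Nat.le_add_right _ _)
  · have := hr ⟨i, h⟩
    exact this.trans (Nat.le_add_left _ _)

variable [Field 𝕜] [LinearOrder 𝕜]

/-- One program computes `f i` from `c i`, for all indices `i`, in time polynomial in `N i`. The
roots of `c i` and `f i` are required to be cheap as well, so that both can be moved around. -/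
def PolyTime (size : 𝕜 → ℕ) (N : ι → ℕ) (c f : ι → Datum 𝕜) : Prop :=
  RootBounded size N c ∧ RootBounded size N f ∧ ∃ (P : Program) (p : Polynomial ℕ),
    ∀ i, Transforms size P (c i) (p.eval (N i)) (f i)

theorem PolyTime.rootBounded_left (hf : PolyTime size N c f) : RootBounded size N c := hf.1

theorem PolyTime.rootBounded (hf : PolyTime size N c f) : RootBounded size N f := hf.2.1

theorem PolyTime.comap (hf : PolyTime size N c f) (φ : κ → ι) :
    PolyTime size (fun k => N (φ k)) (fun k => c (φ k)) fun k => f (φ k) := by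
  obtain ⟨hc, hf, P, p, hP⟩ := hf
  exact ⟨hc.comap φ, hf.comap φ, P, p, fun k => hP (φ k)⟩

theorem PolyTime.of_polyBounded {P : Program} {t : ι → ℕ} (hc : RootBounded size N c)
    (hf : RootBounded size N f) (ht : PolyBounded N t)
    (h : ∀ i, Transforms size P (c i) (t i) (f i)) : PolyTime size N c f := by
  obtain ⟨p, hp⟩ := ht
  exact ⟨hc, hf, P, p, fun i => (h i).mono (hp i)⟩

theorem PolyTime.exists_polyBounded (hf : PolyTime size N c f) :
    ∃ (P : Program) (t : ι → ℕ), PolyBounded N t ∧ ∀ i, Transforms size P (c i) (t i) (f i) := by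
  obtain ⟨hc, hf, P, p, hP⟩ := hf
  exact ⟨P, _, ⟨p, fun i => le_rfl⟩, hP⟩

theorem PolyTime.comp (hf : PolyTime size N c d) (hg : PolyTime size N d f) :
    PolyTime size N c f := by
  obtain ⟨P, t, ht, hP⟩ := hf.exists_polyBounded
  obtain ⟨Q, t', ht', hQ⟩ := hg.exists_polyBounded
  exact .of_polyBounded hf.1 hg.2.1 (ht.add ht') fun i => (hP i).seq (hQ i)

theorem PolyTime.id (hc : RootBounded size N c) : PolyTime size N c c :=
  .of_polyBounded (P := .skip) hc hc (.const 1) fun _ s h0 _ =>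
    ⟨1, le_rfl, s, .skip s, h0, rfl⟩

theorem PolyTime.nil (hc : RootBounded size N c) : PolyTime size N c fun _ => .nil :=
  .of_polyBounded (P := .assign 0 .nil) hc .nil (.const 3) fun _ =>
    Transforms.assign (t := 2) fun s _ => by simp [Expr.eval, Expr.cost]

theorem PolyTime.lit (hc : RootBounded size N c) (m : ℕ) :
    PolyTime size N c fun _ => .num (m : 𝕜) :=
  .of_polyBounded (P := .assign 0 (.lit m)) hc (.const _) (.const _) fun _ =>
    Transforms.assign fun s _ => ⟨by simp [Expr.eval], le_rfl⟩

theorem PolyTime.zero (hc : RootBounded size N c) : PolyTime size N c fun _ => .num (0 : 𝕜) := by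
  simpa only [Nat.cast_zero] using PolyTime.lit hc 0

theorem PolyTime.cons (hf : PolyTime size N c f) (hg : PolyTime size N c g) :
    PolyTime size N c fun i => .cons (f i) (g i) := by
  obtain ⟨P, t, ht, hP⟩ := hf.exists_polyBounded
  obtain ⟨Q, t', ht', hQ⟩ := hg.exists_polyBounded
  exact .of_polyBounded hf.1 .cons
    (((((ht.add ht').add (.const 40)).add ((PolyBounded.const 2).mul hf.1)).add
      ((PolyBounded.const 2).mul hf.2.1)).add hg.2.1) fun i => (hP i).pair (hQ i)

theorem PolyTime.fst (hf : PolyTime size N c fun i => .cons (f i) (g i))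
    (hb : RootBounded size N f) : PolyTime size N c f :=
  hf.comp <| .of_polyBounded (P := .assign 0 (.fst (.var 0))) .cons hb
    ((PolyBounded.const 4).add hb) fun i =>
      (Transforms.assign fun s hs =>
        ⟨by simp [Expr.eval, hs, Datum.fst], by
          simp only [Expr.cost, Expr.eval, hs, Datum.fst, Datum.rootCost_cons]; rfl⟩).mono <| by
        omega

theorem PolyTime.snd (hf : PolyTime size N c fun i => .cons (f i) (g i))
    (hb : RootBounded size N g) : PolyTime size N c g :=
  hf.comp <| .of_polyBounded (P := .assign 0 (.snd (.var 0))) .cons hb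
    ((PolyBounded.const 4).add hb) fun i =>
      (Transforms.assign fun s hs =>
        ⟨by simp [Expr.eval, hs, Datum.snd], by
          simp only [Expr.cost, Expr.eval, hs, Datum.snd, Datum.rootCost_cons]; rfl⟩).mono <| by
        omega

variable {a b : ι → 𝕜}

theorem PolyTime.add (ha : PolyTime size N c fun i => .num (a i))
    (hb : PolyTime size N c fun i => .num (b i)) (hs : PolyBounded N fun i => size (a i + b i)) :
    PolyTime size N c fun i => .num (a i + b i) := by
  have h₁ : PolyBounded N fun i => size (a i) := ha.rootBounded
  have h₂ : PolyBounded N fun i => size (b i) := hb.rootBounded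
  refine (ha.cons hb).comp <| .of_polyBounded
    (P := .assign 0 (.add (.fst (.var 0)) (.snd (.var 0)))) .cons hs
    ((PolyBounded.const 1).add (((h₁.add h₂).add hs).add (.const 7))) fun i =>
      Transforms.assign fun s hs => ⟨?_, ?_⟩
  · simp [Expr.eval, hs, Datum.snd, Datum.fst, Datum.arith]
  · simp only [Expr.cost, Expr.eval, hs, Datum.snd, Datum.fst, Datum.arith, Datum.rootCost_num,
      Datum.rootCost_cons]
    omega

theorem PolyTime.mul (ha : PolyTime size N c fun i => .num (a i))
    (hb : PolyTime size N c fun i => .num (b i)) (hs : PolyBounded N fun i => size (a i * b i)) :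
    PolyTime size N c fun i => .num (a i * b i) := by
  have h₁ : PolyBounded N fun i => size (a i) := ha.rootBounded
  have h₂ : PolyBounded N fun i => size (b i) := hb.rootBounded
  refine (ha.cons hb).comp <| .of_polyBounded
    (P := .assign 0 (.mul (.fst (.var 0)) (.snd (.var 0)))) .cons hs
    ((PolyBounded.const 1).add (((h₁.add h₂).add hs).add (.const 7))) fun i =>
      Transforms.assign fun s hs => ⟨?_, ?_⟩
  · simp [Expr.eval, hs, Datum.snd, Datum.fst, Datum.arith]
  · simp only [Expr.cost, Expr.eval, hs, Datum.snd, Datum.fst, Datum.arith, Datum.rootCost_num,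
      Datum.rootCost_cons]
    omega

/-- Branching, with a test `b` on the datum `d i` that decides the property `p i`. -/
theorem PolyTime.branch {p : ι → Prop} (b : Test) (hd : PolyTime size N c d)
    (hb : ∃ t : ι → ℕ, PolyBounded N t ∧ ∀ i, ∀ s : Store 𝕜, s 0 = .cons (d i) (c i) →
      (b.Holds s ↔ p i) ∧ b.cost size s ≤ t i)
    (hp : PolyTime size (fun i : {i // p i} => N i) (fun i => c i) fun i => f i)
    (hn : PolyTime size (fun i : {i // ¬ p i} => N i) (fun i => c i) fun i => f i) :
    PolyTime size N c f := by
  obtain ⟨t, ht, hb⟩ := hb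
  have key : ∀ q : ι → Prop,
      PolyTime size (fun i : {i // q i} => N i) (fun i => c i) (fun i => f i) →
      PolyTime size (fun i : {i // q i} => N i) (fun i => .cons (d i) (c i)) fun i => f i :=
    fun q hq => (PolyTime.snd (.id .cons) (hd.rootBounded_left.comap _)).comp hq
  obtain ⟨-, -, P, q, hP⟩ := key _ hp
  obtain ⟨-, -, Q, r, hQ⟩ := key _ hn
  refine (hd.cons (.id hd.rootBounded_left)).comp <|
    .of_polyBounded (P := .ite b P Q) .cons (.of_cases hp.rootBounded hn.rootBounded)
      (ht.add ⟨q + r, fun i => le_rfl⟩) fun i => ?_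
  rw [Polynomial.eval_add]
  by_cases h : p i
  · exact (Transforms.ite_pos (fun s hs => ⟨((hb i s hs).1).2 h, (hb i s hs).2⟩) (hP ⟨i, h⟩)).mono
      (by simp only; omega)
  · exact (Transforms.ite_neg (fun s hs => ⟨fun h' => h (((hb i s hs).1).1 h'), (hb i s hs).2⟩)
      (hQ ⟨i, h⟩)).mono (by simp only; omega)

theorem PolyTime.ite_isNum {p : ι → Prop} (hd : PolyTime size N c d)
    (hb : ∀ i, (∃ a, d i = .num a) ↔ p i)
    (hp : PolyTime size (fun i : {i // p i} => N i) (fun i => c i) fun i => f i)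
    (hn : PolyTime size (fun i : {i // ¬ p i} => N i) (fun i => c i) fun i => f i) :
    PolyTime size N c f := by
  refine PolyTime.branch (.isNum (.fst (.var 0))) hd
    ⟨_, (PolyBounded.const 10).add hd.rootBounded, fun i s hs => ⟨?_, ?_⟩⟩ hp hn
  · simp only [Test.Holds, Expr.eval, hs, Datum.fst, hb]
  · simp only [Test.cost, Expr.cost, Expr.eval, hs, Datum.fst, Datum.rootCost_cons]
    omega

theorem PolyTime.ite_lt {p : ι → Prop} (ha : PolyTime size N c fun i => .num (a i))
    (hb : PolyTime size N c fun i => .num (b i)) (h : ∀ i, a i < b i ↔ p i)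
    (hp : PolyTime size (fun i : {i // p i} => N i) (fun i => c i) fun i => f i)
    (hn : PolyTime size (fun i : {i // ¬ p i} => N i) (fun i => c i) fun i => f i) :
    PolyTime size N c f := by
  have h₁ : PolyBounded N fun i => size (a i) := ha.rootBounded
  have h₂ : PolyBounded N fun i => size (b i) := hb.rootBounded
  refine PolyTime.branch (.lt (.fst (.fst (.var 0))) (.snd (.fst (.var 0)))) (ha.cons hb)
    ⟨_, ((PolyBounded.const 20).add h₁).add h₂, fun i s hs => ⟨?_, ?_⟩⟩ hp hn
  · simp [Test.Holds, Expr.eval, hs, Datum.fst, Datum.snd, h]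
  · simp only [Test.cost, Expr.cost, Expr.eval, hs, Datum.fst, Datum.snd, Datum.rootCost_cons,
      Datum.rootCost_num]
    omega

/-! ### Loops over lists -/

/-- A loop over the list `l i`: the body computes the next state from the context, the current
state and the current element. -/
theorem PolyTime.fold {l : ι → List (Datum 𝕜)} {st : ι → ℕ → Datum 𝕜}
    (hl : PolyTime size N c fun i => encodeList (l i))
    (hlen : PolyBounded N fun i => (l i).length)
    (hitem : RootBounded size (fun q : Σ i, Fin (l i).length => N q.1) fun q => (l q.1)[q.2])
    (h0 : PolyTime size N c fun i => st i 0)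
    (hstep : PolyTime size (fun q : Σ i, Fin (l i).length => N q.1)
      (fun q => .cons (c q.1) (.cons (st q.1 q.2) (l q.1)[q.2])) fun q => st q.1 (q.2 + 1)) :
    PolyTime size N c fun i => st i (l i).length := by
  have hc := hl.rootBounded_left
  let S : ι → ℕ → Datum 𝕜 := fun i j => .cons (c i) (.cons (st i j) (encodeList ((l i).drop j)))
  have hstart : PolyTime size N c fun i => S i 0 := by
    simpa [S] using (PolyTime.id hc).cons (h0.cons hl)
  let φ : (Σ i, Fin (l i).length) → ι := Sigma.fst
  have hst : RootBounded size (fun q : Σ i, Fin (l i).length => N q.1) fun q => st q.1 q.2 := by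
    obtain ⟨p, hp⟩ := h0.rootBounded
    obtain ⟨r, hr⟩ := hstep.rootBounded
    refine ⟨p + r, fun ⟨i, j, hj⟩ => ?_⟩
    rw [Polynomial.eval_add]
    cases j with
    | zero => exact (hp i).trans (Nat.le_add_right _ _)
    | succ j => exact (hr ⟨i, j, by omega⟩).trans (Nat.le_add_left _ _)
  have hlast : RootBounded size N fun i => st i (l i).length := by
    obtain ⟨p, hp⟩ := h0.rootBounded
    obtain ⟨r, hr⟩ := hstep.rootBounded
    refine ⟨p + r, fun i => ?_⟩
    rw [Polynomial.eval_add]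
    rcases hn : (l i).length with _ | j
    · simpa only [hn] using (hp i).trans (Nat.le_add_right _ _)
    · simpa only [hn] using (hr ⟨i, j, by omega⟩).trans (Nat.le_add_left _ _)
  have hbody : PolyTime size (fun q : Σ i, Fin (l i).length => N q.1) (fun q => S q.1 q.2)
      fun q => S q.1 (q.2 + 1) := by
    have hS : ∀ q : Σ i, Fin (l i).length, S q.1 q.2 =
        .cons (c q.1) (.cons (st q.1 q.2) (.cons (l q.1)[q.2]
          (encodeList ((l q.1).drop (q.2 + 1))))) := by
      intro q
      simp only [S]
      rw [← List.cons_getElem_drop_succ (h := q.2.isLt)]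
      rfl
    simp only [hS]
    have h₁ := PolyTime.id (size := size) (RootBounded.cons
      (N := fun q : Σ i, Fin (l i).length => N q.1) (f := fun q => c q.1)
      (g := fun q => .cons (st q.1 q.2) (.cons (l q.1)[q.2]
          (encodeList ((l q.1).drop (q.2 + 1))))))
    have h₂ := h₁.fst (hc.comap φ)
    have h₃ := h₁.snd .cons
    have h₄ := h₃.fst hst
    have h₅ := h₃.snd .cons
    have h₆ := h₅.fst hitem
    have h₇ := h₅.snd (.encodeList _)
    exact h₂.cons (((h₂.cons (h₄.cons h₆)).comp hstep).cons h₇)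
  have hloop : PolyTime size N (fun i => S i 0) fun i => S i (l i).length := by
    obtain ⟨-, -, P, p, hP⟩ := hbody
    refine .of_polyBounded (P := .while (.isCons (.snd (.snd (.var 0)))) P) .cons .cons
      (t := fun i => (l i).length * (7 + p.eval (N i)) + 7)
      ((hlen.mul ((PolyBounded.const _).add ⟨p, fun i => le_rfl⟩)).add (.const _)) fun i =>
      Transforms.while _ (S i) (fun j hj s hs => ⟨?_, ?_⟩) fun j hj => hP ⟨i, j, hj⟩
    · simp only [Test.Holds, Expr.eval, hs, S, Datum.snd]
      constructor
      · rintro ⟨u, v, h⟩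
        by_contra hj'
        rw [List.drop_eq_nil_of_le (by omega)] at h
        simp [encodeList] at h
      · intro hj
        rw [← List.cons_getElem_drop_succ (h := hj)]
        exact ⟨_, _, rfl⟩
    · simp [Test.cost, Expr.cost, Expr.eval, hs, S, Datum.snd, rootCost_encodeList]
  have h₁ := (hstart.comp hloop).snd .cons
  exact h₁.fst hlast

end PolyTime

section Lists

variable {𝕜 : Type} [Field 𝕜] [LinearOrder 𝕜] {size : 𝕜 → ℕ} {ι κ : Type*} {N n : ι → ℕ}
  {c d f g : ι → Datum 𝕜}

theorem PolyTime.cons_fst (hf : RootBounded size N f) :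
    PolyTime size N (fun i => .cons (f i) (g i)) f :=
  (PolyTime.id .cons).fst hf

theorem PolyTime.cons_snd (hg : RootBounded size N g) :
    PolyTime size N (fun i => .cons (f i) (g i)) g :=
  (PolyTime.id .cons).snd hg

/-- What is computable from a context is computable from an extension of the context. -/
theorem PolyTime.lift (hf : PolyTime size N c f) (φ : κ → ι) {e : κ → Datum 𝕜} :
    PolyTime size (fun k => N (φ k)) (fun k => .cons (c (φ k)) (e k)) fun k => f (φ k) :=
  (PolyTime.cons_fst (hf.rootBounded_left.comap φ)).comp (hf.comap φ)

/-- The stages of a traversal of the list `l`: a prefix of `l` and the element after it. -/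
abbrev Stage {α : Type*} (l : List α) : Type _ :=
  {q : List α × α // ∃ r, l = q.1 ++ q.2 :: r}

theorem Stage.mem {α : Type*} {l : List α} (q : Stage l) : q.1.2 ∈ l := by
  obtain ⟨q, r, rfl⟩ := q
  simp

theorem Stage.length_lt {α : Type*} {l : List α} (q : Stage l) : q.1.1.length < l.length := by
  obtain ⟨r, hr⟩ := q.2
  have := congrArg List.length hr
  simp only [List.length_append, List.length_cons] at this
  omega

theorem Stage.mem_of_mem {α : Type*} {l : List α} (q : Stage l) {a : α} (ha : a ∈ q.1.1) :
    a ∈ l := by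
  obtain ⟨q, r, rfl⟩ := q
  simp [ha]

/-- A left fold takes polynomial time if its step does, at every stage of the traversal. -/
theorem PolyTime.foldl {α σ : ι → Type*} {encA : ∀ i, α i → Datum 𝕜} {encS : ∀ i, σ i → Datum 𝕜}
    {l : ∀ i, List (α i)} {init : ∀ i, σ i} {step : ∀ i, σ i → α i → σ i}
    (hl : PolyTime size N c fun i => encodeList ((l i).map (encA i)))
    (hlen : PolyBounded N fun i => (l i).length)
    (hitem : RootBounded size (fun q : Σ i, Stage (l i) => N q.1) fun q => encA q.1 q.2.1.2)
    (h0 : PolyTime size N c fun i => encS i (init i))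
    (hstep : PolyTime size (fun q : Σ i, Stage (l i) => N q.1)
      (fun q => .cons (c q.1) (.cons (encS q.1 (q.2.1.1.foldl (step q.1) (init q.1)))
        (encA q.1 q.2.1.2)))
      fun q => encS q.1 (step q.1 (q.2.1.1.foldl (step q.1) (init q.1)) q.2.1.2)) :
    PolyTime size N c fun i => encS i ((l i).foldl (step i) (init i)) := by
  let φ : (Σ i, Fin ((l i).map (encA i)).length) → Σ i, Stage (l i) := fun q =>
    ⟨q.1, ((l q.1).take q.2, (l q.1)[q.2.1]'(by simpa using q.2.2)), (l q.1).drop (q.2 + 1), by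
      simp⟩
  have := PolyTime.fold (l := fun i => (l i).map (encA i))
    (st := fun i j => encS i (((l i).take j).foldl (step i) (init i))) hl (by simpa using hlen)
    (by simpa [φ] using hitem.comap φ) (by simpa using h0) ?_
  · simpa using this
  · have h := hstep.comap φ
    have e : ∀ q : Σ i, Fin ((l i).map (encA i)).length,
        ((l q.1).take (q.2 + 1)).foldl (step q.1) (init q.1) =
          step q.1 (((l q.1).take q.2).foldl (step q.1) (init q.1))
            ((l q.1)[q.2.1]'(by simpa using q.2.2)) := fun q => by
      have hq : (q.2 : ℕ) < (l q.1).length := by simpa using q.2.2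
      rw [← List.take_concat_get' _ _ hq, List.foldl_append]
      rfl
    simpa only [e, Fin.getElem_fin, List.getElem_map] using h

theorem PolyTime.reverse {l : ι → List (Datum 𝕜)}
    (hl : PolyTime size N c fun i => encodeList (l i))
    (hlen : PolyBounded N fun i => (l i).length)
    (hitem : RootBounded size (fun q : Σ i, Stage (l i) => N q.1) fun q => q.2.1.2) :
    PolyTime size N c fun i => encodeList (l i).reverse := by
  have h := PolyTime.foldl (encA := fun _ => _root_.id) (encS := fun _ => encodeList)
    (step := fun i acc a => a :: acc) (init := fun _ => []) (by simpa using hl) hlen hitem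
    (PolyTime.nil hl.rootBounded_left)
    ((PolyTime.cons_snd .cons).comp <|
      (PolyTime.cons_snd hitem).cons (.cons_fst (.encodeList _)))
  simpa using h

end Lists

/-! ### Sizes of numbers -/

section Numbers

variable {𝕜 : Type} [Field 𝕜]

/-- The properties of the size of a number that keep arithmetic polynomial. -/
structure IsArithmeticSize (size : 𝕜 → ℕ) : Prop where
  natCast_le : ∀ m : ℕ, size (m : 𝕜) ≤ m.size + 1
  mul_le : ∀ a b : 𝕜, size (a * b) ≤ size a + size b + 1
  sum_le : ∀ l : List 𝕜, size l.sum ≤ 2 * (l.map size).sum + 2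

theorem isArithmeticSize_unitSize : IsArithmeticSize unitSize where
  natCast_le _ := Nat.le_add_left _ _
  mul_le _ _ := Nat.le_add_left _ _
  sum_le _ := (Nat.le_succ 1).trans (Nat.le_add_left _ _)

theorem natSize_mul_le (a b : ℕ) : (a * b).size ≤ a.size + b.size := by
  rw [Nat.size_le, pow_add]
  exact Nat.mul_lt_mul'' (Nat.lt_size_self a) (Nat.lt_size_self b)

theorem natSize_add_le (a b : ℕ) : (a + b).size ≤ a.size + b.size := by
  rcases Nat.eq_zero_or_pos a with rfl | ha
  · simp
  rcases Nat.eq_zero_or_pos b with rfl | hb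
  · simp
  have h₁ := Nat.lt_size_self a
  have h₂ := Nat.lt_size_self b
  rw [Nat.size_le, pow_add]
  nlinarith

theorem natSize_le_self (a : ℕ) : a.size ≤ a := Nat.size_le.2 Nat.lt_two_pow_self

/-- The size of a sum of rationals is linear in the sizes of the summands: the denominator divides
the product of the denominators, and the absolute value is at most the sum of the numerators. -/
theorem rat_list_sum_bound (l : List ℚ) :
    l.sum.den.size ≤ (l.map fun q => q.den.size).sum + 1 ∧
      ∃ m : ℕ, |l.sum| ≤ m ∧ m.size ≤ (l.map fun q => q.num.natAbs.size).sum := by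
  induction l with
  | nil => exact ⟨by simp, 0, by simp⟩
  | cons q l ih =>
    obtain ⟨h, m, hm, hs⟩ := ih
    refine ⟨?_, q.num.natAbs + m, ?_, ?_⟩
    · have h₁ : (q + l.sum).den ∣ q.den * l.sum.den := Rat.add_den_dvd q l.sum
      have h₂ := Nat.le_of_dvd (Nat.mul_pos q.den_pos l.sum.den_pos) h₁
      have h₃ := (Nat.size_le_size h₂).trans (natSize_mul_le _ _)
      simp only [List.sum_cons, List.map_cons]
      omega
    · have : |q| ≤ (q.num.natAbs : ℚ) := by
        have h1 : (1 : ℚ) ≤ q.den := by exact_mod_cast q.den_pos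
        rw [Nat.cast_natAbs, Int.cast_abs]
        conv_lhs => rw [← Rat.num_div_den q, abs_div, Nat.abs_cast]
        exact div_le_self (abs_nonneg _) h1
      rw [List.sum_cons, Nat.cast_add]
      exact (abs_add_le _ _).trans (add_le_add this hm)
    · simp only [List.map_cons, List.sum_cons]
      exact (natSize_add_le _ _).trans (by omega)

theorem isArithmeticSize_bitSize : IsArithmeticSize bitSize where
  natCast_le m := by simp [bitSize]
  mul_le a b := by
    have h₁ : (a * b).den ∣ a.den * b.den := Rat.mul_den_dvd a b
    have h₃ := (Nat.size_le_size (Nat.le_of_dvd (Nat.mul_pos a.den_pos b.den_pos) h₁)).trans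
      (natSize_mul_le _ _)
    have h₄ : (a * b).num.natAbs.size ≤ a.num.natAbs.size + b.num.natAbs.size := by
      refine (Nat.size_le_size ?_).trans (natSize_mul_le _ _)
      rw [Rat.mul_num, ← Int.natAbs_mul]
      exact Int.natAbs_ediv_le_natAbs _ _
    unfold bitSize
    omega
  sum_le l := by
    obtain ⟨h, m, hm, hs⟩ := rat_list_sum_bound l
    have key : l.sum.num.natAbs ≤ m * l.sum.den := by
      have h₁ : (l.sum.num.natAbs : ℚ) = |l.sum| * l.sum.den := by
        rw [Nat.cast_natAbs, Int.cast_abs]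
        conv_rhs => rw [← Nat.abs_cast l.sum.den, ← abs_mul, Rat.mul_den_eq_num]
      have h₂ : (l.sum.num.natAbs : ℚ) ≤ (m * l.sum.den : ℕ) := by
        rw [h₁, Nat.cast_mul]
        gcongr
      exact_mod_cast h₂
    have h₃ := (Nat.size_le_size key).trans (natSize_mul_le _ _)
    have h₄ : (l.map bitSize).sum =
        (l.map fun q => q.num.natAbs.size).sum + (l.map fun q => q.den.size).sum := by
      rw [← List.sum_map_add]
      rfl
    unfold bitSize at h₄ ⊢
    omega

end Numbers

/-! ### Subroutines -/

/-- The expression with every variable renamed from `i` to `i + 2`. -/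
def Expr.shift : Expr → Expr
  | .var i => .var (i + 2)
  | .nil => .nil
  | .lit m => .lit m
  | .cons e f => .cons e.shift f.shift
  | .fst e => .fst e.shift
  | .snd e => .snd e.shift
  | .add e f => .add e.shift f.shift
  | .sub e f => .sub e.shift f.shift
  | .mul e f => .mul e.shift f.shift
  | .div e f => .div e.shift f.shift

/-- A strict upper bound for the variables that occur in an expression. -/
def Expr.varBound : Expr → ℕ
  | .var i => i + 1
  | .nil => 0
  | .lit _ => 0
  | .cons e f => max e.varBound f.varBound
  | .fst e => e.varBound
  | .snd e => e.varBound
  | .add e f => max e.varBound f.varBound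
  | .sub e f => max e.varBound f.varBound
  | .mul e f => max e.varBound f.varBound
  | .div e f => max e.varBound f.varBound

/-- The condition with every variable renamed from `i` to `i + 2`. -/
def Test.shift : Test → Test
  | .isCons e => .isCons e.shift
  | .isNum e => .isNum e.shift
  | .lt e f => .lt e.shift f.shift

/-- A strict upper bound for the variables that occur in a condition. -/
def Test.varBound : Test → ℕ
  | .isCons e => e.varBound
  | .isNum e => e.varBound
  | .lt e f => max e.varBound f.varBound

/-- The program with every variable renamed from `i` to `i + 2`. -/
def Program.shift : Program → Program
  | .skip => .skip
  | .assign i e => .assign (i + 2) e.shift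
  | .seq P Q => .seq P.shift Q.shift
  | .ite b P Q => .ite b.shift P.shift Q.shift
  | .while b P => .while b.shift P.shift

/-- A strict upper bound for the variables that occur in a program. -/
def Program.varBound : Program → ℕ
  | .skip => 0
  | .assign i e => max (i + 1) e.varBound
  | .seq P Q => max P.varBound Q.varBound
  | .ite b P Q => max b.varBound (max P.varBound Q.varBound)
  | .while b P => max b.varBound P.varBound

/-- Reset the variables `2, …, m + 1`. -/
def Program.clear : ℕ → Program
  | 0 => .skip
  | m + 1 => .seq (Program.clear m) (.assign (m + 2) .nil)

/-- `P` as a subroutine: it runs on its own variables, which are reset before, and leaves the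
stack alone. -/
def Program.isolate (P : Program) : Program :=
  .seq (.clear (P.varBound + 1)) <| .seq (.assign 2 (.var 0)) <| .seq P.shift (.assign 0 (.var 2))

section Subroutines

variable {𝕜 : Type} [Field 𝕜] {size : 𝕜 → ℕ} {m : ℕ} {s s' σ : Store 𝕜}

theorem Expr.shift_spec (h : ∀ i < m, σ (i + 2) = s i) (e : Expr) (he : e.varBound ≤ m) :
    e.shift.eval σ = e.eval s ∧ e.shift.cost size σ = e.cost size s := by
  induction e with
  | var i => simp [Expr.shift, Expr.eval, Expr.cost, h i he]
  | nil | lit m => simp [Expr.shift, Expr.eval, Expr.cost]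
  | fst e ih | snd e ih =>
    have := ih he
    simp [Expr.shift, Expr.eval, Expr.cost, this]
  | cons e f ihe ihf | add e f ihe ihf | sub e f ihe ihf | mul e f ihe ihf | div e f ihe ihf =>
    obtain ⟨he, hf⟩ := max_le_iff.1 he
    simp [Expr.shift, Expr.eval, Expr.cost, ihe he, ihf hf]

variable [LinearOrder 𝕜]

theorem Test.shift_spec (h : ∀ i < m, σ (i + 2) = s i) (b : Test) (hb : b.varBound ≤ m) :
    (b.shift.Holds σ ↔ b.Holds s) ∧ b.shift.cost size σ = b.cost size s := by
  cases b with
  | isCons e | isNum e =>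
    simp [Test.shift, Test.Holds, Test.cost, Expr.shift_spec (size := size) h e hb]
  | lt e f =>
    obtain ⟨he, hf⟩ := max_le_iff.1 hb
    simp [Test.shift, Test.Holds, Test.cost, Expr.shift_spec (size := size) h e he,
      Expr.shift_spec (size := size) h f hf]

theorem Exec.shift {P : Program} {t : ℕ} (hP : Exec size P s t s') (hm : P.varBound ≤ m)
    (h : ∀ i < m, σ (i + 2) = s i) :
    ∃ σ' : Store 𝕜, Exec size P.shift σ t σ' ∧ (∀ i < m, σ' (i + 2) = s' i) ∧
      σ' 0 = σ 0 ∧ σ' 1 = σ 1 := by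
  induction hP generalizing σ with
  | skip s => exact ⟨σ, .skip σ, h, rfl, rfl⟩
  | assign i e s =>
    obtain ⟨hi, he⟩ := max_le_iff.1 hm
    obtain ⟨h₁, h₂⟩ := Expr.shift_spec (size := size) h e he
    have hx := Exec.assign (size := size) (i + 2) e.shift σ
    rw [h₁, h₂] at hx
    refine ⟨_, hx, fun j hj => ?_, by simp, ?_⟩
    · rcases eq_or_ne j i with rfl | hne
      · simp
      · simp [hne, h j hj]
    · exact Function.update_of_ne (by omega) _ _
  | seq _ _ ihP ihQ =>
    obtain ⟨hp, hq⟩ := max_le_iff.1 hm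
    obtain ⟨σ₁, e₁, h₁, a₁, b₁⟩ := ihP hp h
    obtain ⟨σ₂, e₂, h₂, a₂, b₂⟩ := ihQ hq h₁
    exact ⟨σ₂, e₁.seq e₂, h₂, a₂.trans a₁, b₂.trans b₁⟩
  | iteTrue hb _ ih =>
    obtain ⟨hb', hpq⟩ := max_le_iff.1 hm
    obtain ⟨hp, hq⟩ := max_le_iff.1 hpq
    obtain ⟨hs, hc⟩ := Test.shift_spec (size := size) h _ hb'
    obtain ⟨σ₁, e₁, r⟩ := ih hp h
    exact ⟨σ₁, hc ▸ e₁.iteTrue (hs.2 hb), r⟩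
  | iteFalse hb _ ih =>
    obtain ⟨hb', hpq⟩ := max_le_iff.1 hm
    obtain ⟨hp, hq⟩ := max_le_iff.1 hpq
    obtain ⟨hs, hc⟩ := Test.shift_spec (size := size) h _ hb'
    obtain ⟨σ₁, e₁, r⟩ := ih hq h
    exact ⟨σ₁, hc ▸ e₁.iteFalse fun h => hb (hs.1 h), r⟩
  | whileTrue hb _ _ ihP ihW =>
    obtain ⟨hb', hp⟩ := max_le_iff.1 hm
    obtain ⟨hs, hc⟩ := Test.shift_spec (size := size) h _ hb'
    obtain ⟨σ₁, e₁, h₁, a₁, b₁⟩ := ihP hp h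
    obtain ⟨σ₂, e₂, h₂, a₂, b₂⟩ := ihW hm h₁
    exact ⟨σ₂, hc ▸ .whileTrue (hs.2 hb) e₁ e₂, h₂, a₂.trans a₁, b₂.trans b₁⟩
  | whileFalse hb =>
    obtain ⟨hb', hp⟩ := max_le_iff.1 hm
    obtain ⟨hs, hc⟩ := Test.shift_spec (size := size) h _ hb'
    exact ⟨σ, hc ▸ .whileFalse fun h => hb (hs.1 h), h, rfl, rfl⟩

theorem exec_clear (m : ℕ) (s : Store 𝕜) :
    ∃ s' : Store 𝕜, Exec size (.clear m) s (3 * m + 1) s' ∧ (∀ i < m, s' (i + 2) = .nil) ∧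
      s' 0 = s 0 ∧ s' 1 = s 1 := by
  induction m with
  | zero => exact ⟨s, .skip s, by simp, rfl, rfl⟩
  | succ m ih =>
    obtain ⟨s₁, e₁, h₁, a₁, b₁⟩ := ih
    refine ⟨_, e₁.seq (.assign (m + 2) .nil s₁), fun i hi => ?_, by simp [a₁], ?_⟩
    · rcases eq_or_ne i m with rfl | hne
      · simp [Expr.eval]
      · simp [hne, h₁ i (by omega)]
    · rw [Function.update_of_ne (by omega), b₁]

theorem Runs.transforms_isolate {P : Program} {u v : Datum 𝕜} {t : ℕ} (h : Runs size P u t v) :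
    Transforms size P.isolate u
      (t + 3 * P.varBound + 20 + u.rootCost size + v.rootCost size) v := by
  obtain ⟨s', hP, hv⟩ := h
  intro s h0 h1
  obtain ⟨s₁, e₁, h₁, a₁, b₁⟩ := exec_clear (size := size) (P.varBound + 1) s
  have e₂ := Exec.assign (size := size) 2 (.var 0) s₁
  obtain ⟨σ, e₃, h₃, a₃, b₃⟩ := hP.shift (m := P.varBound + 1) (Nat.le_succ _)
    (σ := Function.update s₁ 2 (s₁ 0)) fun i hi => by
      cases i with
      | zero => simp [a₁, h0]
      | succ i => simp [h₁ _ hi]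
  have e₄ := Exec.assign (size := size) 0 (.var 2) σ
  have hσ : σ 2 = v := (h₃ 0 (by omega)).trans hv
  simp only [Expr.cost, Expr.eval, hσ, a₁, h0] at e₂ e₃ e₄
  refine ⟨_, ?_, _, e₁.seq (e₂.seq (e₃.seq e₄)), by simp, ?_⟩
  · omega
  · rw [Function.update_of_ne (by omega), b₃, Function.update_of_ne (by omega), b₁]

/-- A program has no time to create numbers whose handling exceeds its running time. -/
theorem Exec.rootCost_le {P : Program} {t : ℕ} (h : Exec size P s t s') (i : ℕ) :
    s' i = s i ∨ (s' i).rootCost size ≤ t := by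
  induction h with
  | skip s => exact .inl rfl
  | assign j e s =>
    rcases eq_or_ne i j with rfl | hne
    · right
      rw [Function.update_self]
      cases e <;> simp only [Expr.cost, Expr.eval] <;> omega
    · exact .inl (Function.update_of_ne hne _ _)
  | seq _ _ ihP ihQ =>
    rcases ihQ with h | h
    · rw [h]
      exact ihP.imp_right fun h => by omega
    · exact .inr (by omega)
  | iteTrue _ _ ih => exact ih.imp_right fun h => by omega
  | iteFalse _ _ ih => exact ih.imp_right fun h => by omega
  | whileTrue _ _ _ ihP ihQ =>
    rcases ihQ with h | h
    · rw [h]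
      exact ihP.imp_right fun h => by omega
    · exact .inr (by omega)
  | whileFalse _ => exact .inl rfl

theorem PolyTime.of_runs {ι : Type*} {N : ι → ℕ} {a b f : ι → Datum 𝕜} {P : Program}
    {p : Polynomial ℕ}
    (h : ∀ i, ∃ t ≤ p.eval (N i), Runs size P (.cons (a i) (b i)) t (f i)) :
    PolyTime size N (fun i => .cons (a i) (b i)) f := by
  have hp : PolyBounded N fun i => p.eval (N i) := ⟨p, fun i => le_rfl⟩
  have hf : RootBounded size N f := by
    refine (hp.add (.const 1)).mono fun i => ?_
    obtain ⟨t, ht, s', hs, hv⟩ := h i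
    rcases hs.rootCost_le 0 with h | h
    · rw [← hv, h, Function.update_self]
      exact Nat.le_add_left _ _
    · rw [← hv]
      omega
  refine .of_polyBounded (P := P.isolate) .cons hf
    ((hp.add hf).add (.const (3 * P.varBound + 21))) fun i => ?_
  obtain ⟨t, ht, hr⟩ := h i
  refine hr.transforms_isolate.mono ?_
  rw [Datum.rootCost_cons]
  omega

theorem PolyTime.exists_runs {ι : Type*} {N : ι → ℕ} {c f : ι → Datum 𝕜}
    (h : PolyTime size N c f) :
    ∃ (P : Program) (p : Polynomial ℕ), ∀ i, ∃ t ≤ p.eval (N i), Runs size P (c i) t (f i) := by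
  obtain ⟨-, -, P, p, hP⟩ := h
  exact ⟨P, p, fun i => (hP i).runs⟩

end Subroutines

/-! ### Natural numbers and arrays -/

section Arrays

variable {𝕜 : Type} [Field 𝕜] {size : 𝕜 → ℕ} {ι : Type*} {N n : ι → ℕ}
  {c f : ι → Datum 𝕜} {a b : ι → ℕ}

theorem IsArithmeticSize.rootBounded_natCast (hz : IsArithmeticSize size)
    (ha : PolyBounded N fun i => (a i).size) : RootBounded size N fun i => .num (a i : 𝕜) :=
  (ha.add (.const 1)).mono fun i => hz.natCast_le (a i)

theorem PolyBounded.natSize (ha : PolyBounded N a) : PolyBounded N fun i => (a i).size :=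
  ha.mono fun i => natSize_le_self (a i)

variable [LinearOrder 𝕜]

theorem PolyTime.natAdd (hz : IsArithmeticSize size)
    (ha : PolyTime size N c fun i => .num (a i : 𝕜))
    (hb : PolyTime size N c fun i => .num (b i : 𝕜))
    (h : PolyBounded N fun i => (a i + b i).size) :
    PolyTime size N c fun i => .num ((a i + b i : ℕ) : 𝕜) := by
  have h' := hz.rootBounded_natCast h
  simp only [Nat.cast_add] at h' ⊢
  exact ha.add hb h'

theorem PolyTime.natMul (hz : IsArithmeticSize size)
    (ha : PolyTime size N c fun i => .num (a i : 𝕜))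
    (hb : PolyTime size N c fun i => .num (b i : 𝕜))
    (h : PolyBounded N fun i => (a i * b i).size) :
    PolyTime size N c fun i => .num ((a i * b i : ℕ) : 𝕜) := by
  have h' := hz.rootBounded_natCast h
  simp only [Nat.cast_mul] at h' ⊢
  exact ha.mul hb h'

variable [IsStrictOrderedRing 𝕜]

theorem PolyTime.ite_natEq {p : ι → Prop} (ha : PolyTime size N c fun i => .num (a i : 𝕜))
    (hb : PolyTime size N c fun i => .num (b i : 𝕜)) (h : ∀ i, a i = b i ↔ p i)
    (hp : PolyTime size (fun i : {i // p i} => N i) (fun i => c i) fun i => f i)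
    (hn : PolyTime size (fun i : {i // ¬ p i} => N i) (fun i => c i) fun i => f i) :
    PolyTime size N c f := by
  refine PolyTime.ite_lt (p := fun i => a i < b i) ha hb (fun i => Nat.cast_lt) ?_ ?_
  · exact hn.comap fun i : {i // a i < b i} => (⟨i, by rw [← h]; exact i.2.ne⟩ : {i // ¬ p i})
  · refine PolyTime.ite_lt (p := fun i : {i // ¬ a i < b i} => b i < a i) (hb.comap _) (ha.comap _)
      (fun i => Nat.cast_lt) ?_ ?_
    · exact hn.comap fun i : {i : {i // ¬ a i < b i} // b i < a i} =>
        (⟨i.1, by rw [← h]; exact i.2.ne'⟩ : {i // ¬ p i})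
    · exact hp.comap fun i : {i : {i // ¬ a i < b i} // ¬ b i < a i} =>
        (⟨i.1, by rw [← h]; have := i.1.2; have := i.2; omega⟩ : {i // p i})

/-- A loop over an array, in which the body also has access to the current position. -/
theorem PolyTime.foldFin (hz : IsArithmeticSize size) (hn : PolyBounded N n)
    {x : ∀ i, Fin (n i) → Datum 𝕜} {st : ι → ℕ → Datum 𝕜}
    (hx : PolyTime size N c fun i => encodeList (List.ofFn (x i)))
    (hitem : RootBounded size (fun q : Σ i, Fin (n i) => N q.1) fun q => x q.1 q.2)
    (h0 : PolyTime size N c fun i => st i 0)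
    (hstep : PolyTime size (fun q : Σ i, Fin (n i) => N q.1)
      (fun q => .cons (c q.1) (.cons (.cons (.num (q.2 : ℕ)) (st q.1 q.2)) (x q.1 q.2)))
      fun q => st q.1 (q.2 + 1)) :
    PolyTime size N c fun i => st i (n i) := by
  let φ : (Σ i, Fin (List.ofFn (x i)).length) → Σ i, Fin (n i) := fun q =>
    ⟨q.1, q.2, by simpa using q.2.2⟩
  have hst : RootBounded size (fun q : Σ i, Fin (n i) => N q.1) fun q => st q.1 q.2 := by
    obtain ⟨p, hp⟩ := h0.rootBounded
    obtain ⟨r, hr⟩ := hstep.rootBounded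
    refine ⟨p + r, fun ⟨i, j, hj⟩ => ?_⟩
    rw [Polynomial.eval_add]
    cases j with
    | zero => exact (hp i).trans (Nat.le_add_right _ _)
    | succ j => exact (hr ⟨i, j, by omega⟩).trans (Nat.le_add_left _ _)
  have hend : RootBounded size N fun i => st i (n i) := by
    obtain ⟨p, hp⟩ := h0.rootBounded
    obtain ⟨r, hr⟩ := hstep.rootBounded
    refine ⟨p + r, fun i => ?_⟩
    rw [Polynomial.eval_add]
    rcases hn : n i with _ | j
    · simpa only [hn] using (hp i).trans (Nat.le_add_right _ _)
    · simpa only [hn] using (hr ⟨i, j, by omega⟩).trans (Nat.le_add_left _ _)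
  have hpos : PolyBounded (fun q : Σ i, Fin (n i) => N q.1) fun q => (q.2 : ℕ) :=
    (hn.comap (Sigma.fst : (Σ i, Fin (n i)) → ι)).mono fun q => q.2.isLt.le
  have hnum := hz.rootBounded_natCast hpos.natSize
  have hbody : PolyTime size (fun q : Σ i, Fin (n i) => N q.1)
      (fun q => .cons (c q.1) (.cons (.cons (.num (q.2 : ℕ)) (st q.1 q.2)) (x q.1 q.2)))
      fun q => .cons (.num ((q.2 + 1 : ℕ) : 𝕜)) (st q.1 (q.2 + 1)) := by
    refine PolyTime.cons ?_ hstep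
    have h₁ := (PolyTime.cons_snd (size := size) (N := fun q : Σ i, Fin (n i) => N q.1)
      (f := fun q => c q.1) .cons).comp <| (PolyTime.cons_fst
        (f := fun q => .cons (.num ((q.2 : ℕ) : 𝕜)) (st q.1 q.2)) (g := fun q => x q.1 q.2)
        .cons).comp (.cons_fst hnum)
    refine h₁.natAdd (b := fun _ => 1) hz (PolyTime.lit .cons 1) ?_
    exact (hpos.add (.const 1)).natSize
  have := PolyTime.fold (l := fun i => List.ofFn (x i))
    (st := fun i j => .cons (.num (j : 𝕜)) (st i j)) hx (by simpa using hn)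
    (by simpa [φ] using hitem.comap φ)
    (.cons (by simpa using PolyTime.zero hx.rootBounded_left) h0)
    (by simpa [φ] using hbody.comap φ)
  simp only [List.length_ofFn] at this
  exact this.snd hend

/-- An array is computed in polynomial time if each of its entries is. -/
theorem PolyTime.mapFin (hz : IsArithmeticSize size) (hn : PolyBounded N n)
    {x y : ∀ i, Fin (n i) → Datum 𝕜}
    (hx : PolyTime size N c fun i => encodeList (List.ofFn (x i)))
    (hitem : RootBounded size (fun q : Σ i, Fin (n i) => N q.1) fun q => x q.1 q.2)
    (hstep : PolyTime size (fun q : Σ i, Fin (n i) => N q.1)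
      (fun q => .cons (c q.1) (.cons (.num (q.2 : ℕ)) (x q.1 q.2))) fun q => y q.1 q.2) :
    PolyTime size N c fun i => encodeList (List.ofFn (y i)) := by
  have hpos : PolyBounded (fun q : Σ i, Fin (n i) => N q.1) fun q => (q.2 : ℕ) :=
    (hn.comap (Sigma.fst : (Σ i, Fin (n i)) → ι)).mono fun q => q.2.isLt.le
  have hnum := hz.rootBounded_natCast hpos.natSize
  have hrev : PolyTime size N c fun i => encodeList (List.ofFn (y i)).reverse := by
    have := PolyTime.foldFin hz hn (st := fun i j => encodeList ((List.ofFn (y i)).take j).reverse)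
      hx hitem (by simpa [encodeList] using PolyTime.nil hx.rootBounded_left) ?_
    · simpa [List.take_of_length_le] using this
    · have e : ∀ q : Σ i, Fin (n i), encodeList ((List.ofFn (y q.1)).take (q.2 + 1)).reverse =
          .cons (y q.1 q.2) (encodeList ((List.ofFn (y q.1)).take q.2).reverse) := fun q => by
        rw [← List.take_concat_get' _ _ (by simp), List.reverse_append]
        simp [encodeList]
      simp only [e]
      have hc := hx.rootBounded_left.comap (Sigma.fst : (Σ i, Fin (n i)) → ι)
      have h₁ := PolyTime.id (size := size) (RootBounded.cons
        (N := fun q : Σ i, Fin (n i) => N q.1) (f := fun q => c q.1)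
        (g := fun q => .cons (.cons (.num ((q.2 : ℕ) : 𝕜))
          (encodeList ((List.ofFn (y q.1)).take q.2).reverse)) (x q.1 q.2)))
      have h₂ := h₁.snd .cons
      have h₃ := h₂.fst .cons
      exact PolyTime.cons (((h₁.fst hc).cons ((h₃.fst hnum).cons (h₂.snd hitem))).comp hstep)
        (h₃.snd (.encodeList _))
  have := hrev.reverse (by simpa using hn) ?_
  · simpa using this
  · have hy := hstep.rootBounded
    obtain ⟨p, hp⟩ := hy
    refine ⟨p, fun q => ?_⟩
    have hq := q.2.mem
    rw [List.mem_reverse, List.mem_ofFn] at hq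
    obtain ⟨j, hj⟩ := hq
    simpa only [hj] using hp ⟨q.1, j⟩

/-- Array access: after `j` steps of the loop the state is the wanted entry if its position is
less than `j`. -/
theorem PolyTime.getFin (hz : IsArithmeticSize size) (hn : PolyBounded N n)
    {x : ∀ i, Fin (n i) → Datum 𝕜} {v : ∀ i, Fin (n i)}
    (hx : PolyTime size N c fun i => encodeList (List.ofFn (x i)))
    (hitem : RootBounded size (fun q : Σ i, Fin (n i) => N q.1) fun q => x q.1 q.2)
    (hv : PolyTime size N c fun i => .num ((v i : ℕ) : 𝕜)) :
    PolyTime size N c fun i => x i (v i) := by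
  have hpos : PolyBounded (fun q : Σ i, Fin (n i) => N q.1) fun q => (q.2 : ℕ) :=
    (hn.comap (Sigma.fst : (Σ i, Fin (n i)) → ι)).mono fun q => q.2.isLt.le
  have hnum := hz.rootBounded_natCast hpos.natSize
  have hget : RootBounded size N fun i => x i (v i) :=
    hitem.comap fun i => (⟨i, v i⟩ : Σ i, Fin (n i))
  have hst : RootBounded size (fun q : Σ i, Fin (n i) => N q.1)
      fun q => if (v q.1 : ℕ) < q.2 then x q.1 (v q.1) else .nil := by
    obtain ⟨p, hp⟩ := hget
    refine ⟨p + 1, fun q => ?_⟩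
    rw [Polynomial.eval_add, Polynomial.eval_one]
    dsimp only
    split_ifs
    · exact (hp q.1).trans (Nat.le_succ _)
    · exact Nat.le_add_left _ _
  have := PolyTime.foldFin hz hn (st := fun i j => if (v i : ℕ) < j then x i (v i) else .nil)
    hx hitem (by simpa using PolyTime.nil hx.rootBounded_left) ?_
  · simpa using this
  · have h₁ := PolyTime.id (size := size) (RootBounded.cons
      (N := fun q : Σ i, Fin (n i) => N q.1) (f := fun q => c q.1)
      (g := fun q => .cons (.cons (.num ((q.2 : ℕ) : 𝕜))
        (if (v q.1 : ℕ) < q.2 then x q.1 (v q.1) else .nil)) (x q.1 q.2)))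
    have h₂ := h₁.snd .cons
    have h₃ := h₂.fst .cons
    have h₄ := h₂.snd hitem
    have h₅ := h₃.snd hst
    refine PolyTime.ite_natEq (p := fun q => v q.1 = q.2)
      (hv.lift (Sigma.fst : (Σ i, Fin (n i)) → ι)) (h₃.fst hnum) (fun q => Fin.ext_iff.symm) ?_ ?_
    · have e : ∀ q : {q : Σ i, Fin (n i) // v q.1 = q.2},
          (if (v q.1.1 : ℕ) < q.1.2 + 1 then x q.1.1 (v q.1.1) else .nil) = x q.1.1 q.1.2 := by
        intro q
        rw [q.2, if_pos (Nat.lt_succ_self _)]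
      simp only [e]
      exact h₄.comap Subtype.val
    · have e : ∀ q : {q : Σ i, Fin (n i) // ¬ v q.1 = q.2},
          (if (v q.1.1 : ℕ) < q.1.2 + 1 then x q.1.1 (v q.1.1) else .nil) =
            if (v q.1.1 : ℕ) < q.1.2 then x q.1.1 (v q.1.1) else .nil := by
        intro q
        have := Fin.val_ne_of_ne q.2
        exact if_congr (by omega) rfl rfl
      simp only [e]
      exact h₅.comap Subtype.val

theorem PolyTime.updateFin (hz : IsArithmeticSize size) (hn : PolyBounded N n)
    {x : ∀ i, Fin (n i) → Datum 𝕜} {v : ∀ i, Fin (n i)}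
    (hx : PolyTime size N c fun i => encodeList (List.ofFn (x i)))
    (hitem : RootBounded size (fun q : Σ i, Fin (n i) => N q.1) fun q => x q.1 q.2)
    (hv : PolyTime size N c fun i => .num ((v i : ℕ) : 𝕜)) (hf : PolyTime size N c f) :
    PolyTime size N c fun i => encodeList (List.ofFn (Function.update (x i) (v i) (f i))) := by
  have hpos : PolyBounded (fun q : Σ i, Fin (n i) => N q.1) fun q => (q.2 : ℕ) :=
    (hn.comap (Sigma.fst : (Σ i, Fin (n i)) → ι)).mono fun q => q.2.isLt.le
  have hnum := hz.rootBounded_natCast hpos.natSize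
  refine PolyTime.mapFin hz hn hx hitem ?_
  have h₂ := PolyTime.cons_snd (size := size) (N := fun q : Σ i, Fin (n i) => N q.1)
    (f := fun q => c q.1) (g := fun q => .cons (.num ((q.2 : ℕ) : 𝕜)) (x q.1 q.2)) .cons
  refine PolyTime.ite_natEq (p := fun q => v q.1 = q.2)
    (hv.lift (Sigma.fst : (Σ i, Fin (n i)) → ι)) (h₂.fst hnum) (fun q => Fin.ext_iff.symm) ?_ ?_
  · have e : ∀ q : {q : Σ i, Fin (n i) // v q.1 = q.2},
        Function.update (x q.1.1) (v q.1.1) (f q.1.1) q.1.2 = f q.1.1 := by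
      intro q
      rw [← q.2, Function.update_self]
    simp only [e]
    have h := hf.lift (Sigma.fst : (Σ i, Fin (n i)) → ι)
      (e := fun q => .cons (.num ((q.2 : ℕ) : 𝕜)) (x q.1 q.2))
    exact h.comap Subtype.val
  · have e : ∀ q : {q : Σ i, Fin (n i) // ¬ v q.1 = q.2},
        Function.update (x q.1.1) (v q.1.1) (f q.1.1) q.1.2 = x q.1.1 q.1.2 := by
      intro q
      rw [Function.update_of_ne (Ne.symm q.2)]
    simp only [e]
    exact (h₂.snd hitem).comap Subtype.val

end Arrays

/-! ### The table of representative completions -/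

/-- A table entry represents `cnt` ways of assigning the variables that have been processed.
The number `key` encodes how often each bit string occurs among the finished blocks, `cur`
encodes the bit string of the current block, and `asg` is one of the represented assignments. -/
structure Entry (n : ℕ) where
  key : ℕ
  cur : ℕ
  cnt : ℕ
  asg : Fin n → Option Bool

section Table

variable {n : ℕ}

/-- Assign the bit `b` to the variable `v` of the current block. If `cur` is `B ^ a` with `a` the
number written by the bits of the current block so far, then this appends the digit `b` to `a`. -/
def Entry.extend (B : ℕ) (E : Entry n) (v : Fin n) (b : Bool) : Entry n :=
  { E with
    cur := E.cur * E.cur * (if b then B else 1)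
    asg := Function.update E.asg v (some b) }

/-- The entries that arise from assigning the variable `v`. -/
def Entry.children (B : ℕ) (E : Entry n) (v : Fin n) : List (Entry n) :=
  match E.asg v with
  | some b => [E.extend B v b]
  | none => [E.extend B v false, E.extend B v true]

/-- Finish the current block. -/
def Entry.close (E : Entry n) : Entry n :=
  { E with key := E.key + E.cur, cur := 1 }

/-- Assign the variable `v` in all entries. -/
def branchVar (B : ℕ) (L : List (Entry n)) (v : Fin n) : List (Entry n) :=
  L.foldl (fun M E => E.children B v ++ M) []

/-- Assign the variables of a block in all entries. -/
def branchBlock (B : ℕ) (L : List (Entry n)) (l : List (Fin n)) : List (Entry n) :=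
  l.foldl (branchVar B) L

/-- Compare the entry `q.1` with the entry `E` of a table, `q.2` being the part of the table that
has been copied. Entries with the same key are united. -/
def mergeStep (q : Entry n × List (Entry n)) (E : Entry n) : Entry n × List (Entry n) :=
  if E.key = q.1.key then ({ q.1 with cnt := q.1.cnt + E.cnt }, q.2) else (q.1, E :: q.2)

/-- Insert the entry `E` into the table `L`. -/
def merge (L : List (Entry n)) (E : Entry n) : List (Entry n) :=
  (L.foldl mergeStep (E, [])).1 :: (L.foldl mergeStep (E, [])).2

/-- Finish the current block in all entries, and unite entries with the same key. -/
def mergeAll (L : List (Entry n)) : List (Entry n) :=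
  L.foldl (fun M E => merge M E.close) []

/-- Process a block. -/
def stepBlock (B : ℕ) (L : List (Entry n)) (l : List (Fin n)) : List (Entry n) :=
  mergeAll (branchBlock B L l)

/-- The entry that represents the assignment `e` before any block is processed. -/
def Entry.start (e : Fin n → Option Bool) : Entry n := ⟨0, 1, 1, e⟩

/-- The table that results from processing the blocks in `bs`, starting with the evidence `e`. -/
def table (B : ℕ) (e : Fin n → Option Bool) (bs : List (List (Fin n))) : List (Entry n) :=
  bs.foldl (stepBlock B) [Entry.start e]

/-- The number of assignments represented by a table. -/
def total (L : List (Entry n)) : ℕ := (L.map Entry.cnt).sum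

theorem foldl_append_children {B : ℕ} {v : Fin n} (L M : List (Entry n)) :
    L.foldl (fun M E => E.children B v ++ M) M = branchVar B L v ++ M := by
  unfold branchVar
  induction L generalizing M with
  | nil => rfl
  | cons E L ih => rw [List.foldl_cons, List.foldl_cons, ih, ih (_ ++ []), List.append_assoc,
      List.append_nil]

theorem branchVar_cons {B : ℕ} {v : Fin n} (E : Entry n) (L : List (Entry n)) :
    branchVar B (E :: L) v = branchVar B L v ++ E.children B v := by
  conv_lhs => unfold branchVar
  rw [List.foldl_cons, foldl_append_children, List.append_nil]

theorem mem_branchVar {B : ℕ} {v : Fin n} {L : List (Entry n)} {E' : Entry n} :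
    E' ∈ branchVar B L v ↔ ∃ E ∈ L, E' ∈ E.children B v := by
  induction L with
  | nil => simp [branchVar]
  | cons E L ih => simp [branchVar_cons, ih, or_comm]

theorem sum_branchVar {R : Type*} [AddCommMonoid R] {B : ℕ} {v : Fin n} (f : Entry n → R)
    (L : List (Entry n)) :
    ((branchVar B L v).map f).sum = (L.map fun E => ((E.children B v).map f).sum).sum := by
  induction L with
  | nil => simp [branchVar]
  | cons E L ih => simp [branchVar_cons, ih, add_comm]

theorem foldl_mergeStep (E : Entry n) (L M : List (Entry n)) :
    L.foldl mergeStep (E, M) =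
      ({ E with cnt := E.cnt + total (L.filter fun E' => E'.key = E.key) },
        (L.filter fun E' => ¬ E'.key = E.key).reverse ++ M) := by
  induction L generalizing E M with
  | nil => simp [total]
  | cons E' L ih =>
    rw [List.foldl_cons]
    by_cases h : E'.key = E.key
    · simp [mergeStep, h, ih, total, add_assoc]
    · simp [mergeStep, h, ih]

theorem merge_eq (L : List (Entry n)) (E : Entry n) :
    merge L E = { E with cnt := E.cnt + total (L.filter fun E' => E'.key = E.key) } ::
      (L.filter fun E' => ¬ E'.key = E.key).reverse := by
  simp [merge, foldl_mergeStep]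

theorem sum_map_filter_add {R : Type*} [AddCommMonoid R] (f : Entry n → R) (L : List (Entry n))
    (p : Entry n → Prop) [DecidablePred p] :
    ((L.filter fun E => p E).map f).sum + ((L.filter fun E => ¬ p E).map f).sum =
      (L.map f).sum := by
  induction L with
  | nil => simp
  | cons E L ih =>
    by_cases h : p E
    · simp [h, ← ih, add_assoc]
    · simp [h, ← ih, add_left_comm]

/-- Merging does not change weighted sums over a table, provided the weight of the entries is
determined by their keys. -/
theorem sum_merge {R : Type*} [CommSemiring R] (f : (Fin n → Option Bool) → R)
    (L : List (Entry n)) (E : Entry n) (h : ∀ E' ∈ L, E'.key = E.key → f E'.asg = f E.asg) :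
    ((merge L E).map fun E => (E.cnt : R) * f E.asg).sum =
      (L.map fun E => (E.cnt : R) * f E.asg).sum + E.cnt * f E.asg := by
  have h₁ : ((L.filter fun E' => E'.key = E.key).map fun E => (E.cnt : R) * f E.asg).sum =
      total (L.filter fun E' => E'.key = E.key) * f E.asg := by
    have : (L.filter fun E' => E'.key = E.key).map (fun E => (E.cnt : R) * f E.asg) =
        (L.filter fun E' => E'.key = E.key).map fun E' => (E'.cnt : R) * f E.asg := by
      refine List.map_congr_left fun E' hE' => ?_
      rw [List.mem_filter] at hE'
      rw [h E' hE'.1 (by simpa using hE'.2)]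
    rw [this, List.sum_map_mul_right, total, Nat.cast_list_sum, List.map_map]
    rfl
  rw [merge_eq, List.map_cons, List.sum_cons, ← sum_map_filter_add _ L fun E' => E'.key = E.key, h₁,
    List.map_reverse, List.sum_reverse]
  push_cast
  ring

theorem total_merge (L : List (Entry n)) (E : Entry n) :
    total (merge L E) = total L + E.cnt := by
  simpa [total] using sum_merge (R := ℕ) (fun _ => 1) L E fun _ _ _ => rfl

theorem mem_merge {L : List (Entry n)} {E E' : Entry n} (h : E' ∈ merge L E) :
    (E'.key = E.key ∧ E'.cur = E.cur ∧ E'.asg = E.asg) ∨ E' ∈ L := by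
  rw [merge_eq, List.mem_cons, List.mem_reverse, List.mem_filter] at h
  rcases h with rfl | h
  · exact .inl ⟨rfl, rfl, rfl⟩
  · exact .inr h.1

theorem length_merge_le (L : List (Entry n)) (E : Entry n) :
    (merge L E).length ≤ L.length + 1 := by
  rw [merge_eq, List.length_cons, List.length_reverse]
  exact Nat.succ_le_succ (List.length_filter_le _ _)

theorem nodup_merge {L : List (Entry n)} (h : (L.map Entry.key).Nodup) (E : Entry n) :
    ((merge L E).map Entry.key).Nodup := by
  rw [merge_eq, List.map_cons, List.map_reverse, List.nodup_cons, List.nodup_reverse]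
  refine ⟨?_, (List.filter_sublist.map _).nodup h⟩
  simp

theorem mergeAll_concat (L : List (Entry n)) (E : Entry n) :
    mergeAll (L ++ [E]) = merge (mergeAll L) E.close := by
  simp [mergeAll]

theorem total_mergeAll (L : List (Entry n)) : total (mergeAll L) = total L := by
  induction L using List.reverseRecOn with
  | nil => rfl
  | append_singleton L E ih =>
    rw [mergeAll_concat, total_merge, ih]
    simp [total, Entry.close]

theorem length_mergeAll_le (L : List (Entry n)) : (mergeAll L).length ≤ L.length := by
  induction L using List.reverseRecOn with
  | nil => simp [mergeAll]
  | append_singleton L E ih =>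
    rw [mergeAll_concat, List.length_append]
    exact (length_merge_le _ _).trans (Nat.succ_le_succ ih)

theorem nodup_mergeAll (L : List (Entry n)) : ((mergeAll L).map Entry.key).Nodup := by
  induction L using List.reverseRecOn with
  | nil => simp [mergeAll]
  | append_singleton L E ih =>
    rw [mergeAll_concat]
    exact nodup_merge ih _

theorem mem_mergeAll {L : List (Entry n)} {E : Entry n} (h : E ∈ mergeAll L) :
    ∃ E' ∈ L, E.key = E'.key + E'.cur ∧ E.cur = 1 ∧ E.asg = E'.asg := by
  induction L using List.reverseRecOn with
  | nil => simp [mergeAll] at h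
  | append_singleton L E' ih =>
    rw [mergeAll_concat] at h
    rcases mem_merge h with h | h
    · exact ⟨E', by simp, h⟩
    · obtain ⟨E'', h, h'⟩ := ih h
      exact ⟨E'', by simp [h], h'⟩

/-! ### Bounds for the table -/

theorem Entry.eq_extend_of_mem_children {B : ℕ} {E E' : Entry n} {v : Fin n}
    (h : E' ∈ E.children B v) : ∃ b, E' = E.extend B v b ∧ ∀ b', E.asg v = some b' → b' = b := by
  unfold Entry.children at h
  split at h
  · rename_i b hb
    exact ⟨b, by simpa using h, by simp [hb]⟩
  · rename_i hb
    simp only [List.mem_cons, List.not_mem_nil, or_false] at h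
    rcases h with h | h
    · exact ⟨false, h, by simp [hb]⟩
    · exact ⟨true, h, by simp [hb]⟩

theorem Entry.length_children_le (B : ℕ) (E : Entry n) (v : Fin n) :
    (E.children B v).length ≤ 2 := by
  unfold Entry.children
  split <;> simp

theorem length_branchVar_le (B : ℕ) (L : List (Entry n)) (v : Fin n) :
    (branchVar B L v).length ≤ 2 * L.length := by
  induction L with
  | nil => simp [branchVar]
  | cons E L ih =>
    have := E.length_children_le B v
    rw [branchVar_cons, List.length_append, List.length_cons]
    omega

theorem total_branchVar_le (B : ℕ) (L : List (Entry n)) (v : Fin n) :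
    total (branchVar B L v) ≤ 2 * total L := by
  rw [total, sum_branchVar, total, ← List.sum_map_mul_left]
  refine List.sum_le_sum fun E _ => ?_
  unfold Entry.children
  split <;> simp [Entry.extend] <;> omega

/-- All relevant quantities of the table `L` are bounded by `m`. -/
structure Tame (m : ℕ) (L : List (Entry n)) : Prop where
  length_le : L.length ≤ m
  key_le : ∀ E ∈ L, E.key ≤ m
  cur_le : ∀ E ∈ L, E.cur ≤ m
  total_lt : total L < 2 ^ m

/-- Assigning `l.length` variables multiplies the table by at most `2 ^ l.length`; each bit squares
`cur` and possibly adds a factor `B`, which leads to the exponent `2 ^ l.length - 1`. -/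
theorem branchBlock_bounds {B : ℕ} (hB : 0 < B) {L : List (Entry n)} (h : ∀ E ∈ L, E.cur = 1)
    (l : List (Fin n)) :
    (branchBlock B L l).length ≤ 2 ^ l.length * L.length ∧
      total (branchBlock B L l) ≤ 2 ^ l.length * total L ∧
      ∀ E ∈ branchBlock B L l, E.cur ≤ B ^ (2 ^ l.length - 1) ∧ ∃ E' ∈ L, E.key = E'.key := by
  induction l using List.reverseRecOn with
  | nil =>
    simp only [branchBlock, List.foldl_nil, List.length_nil, pow_zero, one_mul, le_refl,
      Nat.sub_self, true_and]
    exact fun E hE => ⟨(h E hE).le, E, hE, rfl⟩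
  | append_singleton l v ih =>
    obtain ⟨h₁, h₂, h₃⟩ := ih
    have e : branchBlock B L (l ++ [v]) = branchVar B (branchBlock B L l) v := by
      simp [branchBlock]
    rw [e, List.length_append, List.length_singleton, pow_succ']
    refine ⟨?_, ?_, fun E hE => ?_⟩
    · rw [mul_assoc]
      exact (length_branchVar_le _ _ _).trans (Nat.mul_le_mul_left _ h₁)
    · rw [mul_assoc]
      exact (total_branchVar_le _ _ _).trans (Nat.mul_le_mul_left _ h₂)
    · obtain ⟨E', hE', hE⟩ := mem_branchVar.1 hE
      obtain ⟨b, rfl, -⟩ := Entry.eq_extend_of_mem_children hE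
      obtain ⟨h₄, h₅⟩ := h₃ E' hE'
      refine ⟨?_, h₅⟩
      have : 2 * 2 ^ l.length - 1 = (2 ^ l.length - 1) + (2 ^ l.length - 1) + 1 := by
        have := Nat.one_le_two_pow (n := l.length)
        omega
      rw [this, pow_succ, pow_add]
      refine Nat.mul_le_mul (Nat.mul_le_mul h₄ h₄) ?_
      split_ifs <;> omega

/-- Processing the blocks in `bs` of length at most `w` keeps the table small: its keys are
distinct, and too small to be numerous. -/
theorem table_bounds {B w : ℕ} (hB : 0 < B) (e : Fin n → Option Bool) (bs : List (List (Fin n)))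
    (hw : ∀ l ∈ bs, l.length ≤ w) :
    ((table B e bs).map Entry.key).Nodup ∧ total (table B e bs) ≤ 2 ^ (w * bs.length) ∧
      ∀ E ∈ table B e bs, E.cur = 1 ∧ E.key ≤ bs.length * B ^ 2 ^ w := by
  induction bs using List.reverseRecOn with
  | nil => simp [table, Entry.start, total]
  | append_singleton bs l ih =>
    obtain ⟨h₁, h₂, h₃⟩ := ih fun l hl => hw l (by simp [hl])
    have hl : l.length ≤ w := hw l (by simp)
    have e : table B e (bs ++ [l]) = mergeAll (branchBlock B (table B e bs) l) := by
      simp [table, stepBlock]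
    obtain ⟨-, k₂, k₃⟩ := branchBlock_bounds hB (fun E hE => (h₃ E hE).1) l
    rw [e, List.length_append, List.length_singleton]
    refine ⟨nodup_mergeAll _, ?_, fun E hE => ?_⟩
    · rw [total_mergeAll, mul_add, mul_one, pow_add, mul_comm]
      exact k₂.trans (Nat.mul_le_mul (Nat.pow_le_pow_right two_pos hl) h₂)
    · obtain ⟨E', hE', hk, hc, -⟩ := mem_mergeAll hE
      obtain ⟨hc', E'', hE'', hk'⟩ := k₃ E' hE'
      refine ⟨hc, ?_⟩
      rw [hk, hk', add_mul, one_mul]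
      refine add_le_add (h₃ E'' hE'').2 (hc'.trans (Nat.pow_le_pow_right hB ?_))
      exact (Nat.sub_le _ _).trans (Nat.pow_le_pow_right two_pos hl)

theorem tame_table {B w : ℕ} (hB : 0 < B) (e : Fin n → Option Bool) (bs : List (List (Fin n)))
    (hw : ∀ l ∈ bs, l.length ≤ w) :
    Tame (bs.length * B ^ 2 ^ w + w * bs.length + 1) (table B e bs) := by
  obtain ⟨h₁, h₂, h₃⟩ := table_bounds hB e bs hw
  refine ⟨?_, fun E hE => ?_, fun E hE => ?_, ?_⟩
  -- The keys are distinct natural numbers below a bound, so the bound limits their number.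
  · have h₄ : (table B e bs).map Entry.key ⊆ List.range (bs.length * B ^ 2 ^ w + 1) := by
      intro k hk
      obtain ⟨E, hE, rfl⟩ := List.mem_map.1 hk
      exact List.mem_range.2 (Nat.lt_succ_of_le (h₃ E hE).2)
    have h₅ := (List.subperm_of_subset h₁ h₄).length_le
    rw [List.length_map, List.length_range] at h₅
    omega
  · have := (h₃ E hE).2
    omega
  · have := (h₃ E hE).1
    omega
  · refine h₂.trans_lt (Nat.pow_lt_pow_right one_lt_two ?_)
    omega

theorem tame_branchBlock {B w m : ℕ} (hB : 0 < B) {L : List (Entry n)} (h : ∀ E ∈ L, E.cur = 1)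
    (hL : Tame m L) (l : List (Fin n)) (hl : l.length ≤ w) :
    Tame (2 ^ w * m + m + w + B ^ 2 ^ w) (branchBlock B L l) := by
  obtain ⟨h₁, h₂, h₃⟩ := branchBlock_bounds hB h l
  have hp : 2 ^ l.length ≤ 2 ^ w := Nat.pow_le_pow_right two_pos hl
  refine ⟨?_, fun E hE => ?_, fun E hE => ?_, ?_⟩
  · have := h₁.trans (Nat.mul_le_mul hp hL.length_le)
    omega
  · obtain ⟨E', hE', hk⟩ := (h₃ E hE).2
    have := hL.key_le E' hE'
    omega
  · have := (h₃ E hE).1.trans (Nat.pow_le_pow_right hB ((Nat.sub_le _ 1).trans hp))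
    omega
  · calc total (branchBlock B L l) ≤ 2 ^ w * total L := h₂.trans (Nat.mul_le_mul_right _ hp)
      _ < 2 ^ w * 2 ^ m := Nat.mul_lt_mul_of_pos_left hL.total_lt (by positivity)
      _ = 2 ^ (w + m) := (pow_add _ _ _).symm
      _ ≤ _ := Nat.pow_le_pow_right two_pos (by omega)

theorem tame_mergeAll {m : ℕ} {L : List (Entry n)} (hL : Tame m L) :
    Tame (2 * m + 1) (mergeAll L) := by
  refine ⟨?_, fun E hE => ?_, fun E hE => ?_, ?_⟩
  · have := (length_mergeAll_le L).trans hL.length_le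
    omega
  · obtain ⟨E', hE', h, -⟩ := mem_mergeAll hE
    have := hL.key_le E' hE'
    have := hL.cur_le E' hE'
    omega
  · obtain ⟨E', -, -, h, -⟩ := mem_mergeAll hE
    omega
  · rw [total_mergeAll]
    exact hL.total_lt.trans_le (Nat.pow_le_pow_right two_pos (by omega))

theorem Tame.of_sublist {m : ℕ} {L M : List (Entry n)} (hL : Tame m L) (h : M.Sublist L) :
    Tame m M :=
  ⟨h.length_le.trans hL.length_le, fun E hE => hL.key_le E (h.subset hE),
    fun E hE => hL.cur_le E (h.subset hE),
    ((h.map _).sum_le_sum fun _ _ => Nat.zero_le _).trans_lt hL.total_lt⟩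

theorem Tame.mono {m m' : ℕ} {L : List (Entry n)} (hL : Tame m L) (h : m ≤ m') : Tame m' L :=
  ⟨hL.length_le.trans h, fun E hE => (hL.key_le E hE).trans h,
    fun E hE => (hL.cur_le E hE).trans h,
    hL.total_lt.trans_le (Nat.pow_le_pow_right two_pos h)⟩

end Table

/-! ### The table is computable in polynomial time -/

section Encodings

variable {𝕜 : Type} [Field 𝕜] {n : ℕ}

/-- A value of a variable, `nil` if it is not assigned. -/
def encodeValue (o : Option Bool) : Datum 𝕜 := o.elim .nil encodeBit

/-- A table entry as a tree. -/
def encodeEntry (E : Entry n) : Datum 𝕜 :=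
  .cons (.num (E.key : 𝕜)) (.cons (.num (E.cur : 𝕜)) (.cons (.num (E.cnt : 𝕜))
    (encodeList (List.ofFn fun v => encodeValue (E.asg v)))))

/-- A table as a list of trees. -/
def encodeTable (L : List (Entry n)) : Datum 𝕜 := encodeList (L.map encodeEntry)

/-- A block as the list of its variables. -/
def encodeBlock (l : List (Fin n)) : Datum 𝕜 :=
  encodeList (l.map fun v : Fin n => .num ((v : ℕ) : 𝕜))

end Encodings

section PolyTame

variable {ι κ : Type*} {N : ι → ℕ} {L M : ∀ i, List (Entry (N i))} {E : ∀ i, Entry (N i)}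

/-- All relevant quantities of the tables `L i` are polynomially bounded. -/
def PolyTame (N : ι → ℕ) (L : ∀ i, List (Entry (N i))) : Prop :=
  ∃ m : ι → ℕ, PolyBounded N m ∧ ∀ i, Tame (m i) (L i)

theorem PolyTame.comap (h : PolyTame N L) (φ : κ → ι) :
    PolyTame (fun k => N (φ k)) fun k => L (φ k) := by
  obtain ⟨m, hm, h⟩ := h
  exact ⟨_, hm.comap φ, fun k => h (φ k)⟩

theorem PolyTame.of_sublist (h : PolyTame N L) (hM : ∀ i, (M i).Sublist (L i)) : PolyTame N M := by
  obtain ⟨m, hm, h⟩ := h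
  exact ⟨m, hm, fun i => (h i).of_sublist (hM i)⟩

theorem PolyTame.singleton (h : PolyTame N L) (hE : ∀ i, E i ∈ L i) : PolyTame N fun i => [E i] :=
  h.of_sublist fun i => List.singleton_sublist.2 (hE i)

theorem PolyTame.length (h : PolyTame N L) : PolyBounded N fun i => (L i).length := by
  obtain ⟨m, hm, h⟩ := h
  exact hm.mono fun i => (h i).length_le

theorem PolyTame.key (h : PolyTame N fun i => [E i]) : PolyBounded N fun i => (E i).key := by
  obtain ⟨m, hm, h⟩ := h
  exact hm.mono fun i => (h i).key_le _ (by simp)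

theorem PolyTame.cur (h : PolyTame N fun i => [E i]) : PolyBounded N fun i => (E i).cur := by
  obtain ⟨m, hm, h⟩ := h
  exact hm.mono fun i => (h i).cur_le _ (by simp)

theorem PolyTame.total_size (h : PolyTame N L) : PolyBounded N fun i => (total (L i)).size := by
  obtain ⟨m, hm, h⟩ := h
  exact hm.mono fun i => Nat.size_le.2 (h i).total_lt

theorem PolyTame.cnt_size (h : PolyTame N fun i => [E i]) :
    PolyBounded N fun i => (E i).cnt.size := by
  simpa [total] using h.total_size

theorem PolyTame.close (h : PolyTame N fun i => [E i]) : PolyTame N fun i => [(E i).close] := by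
  obtain ⟨m, hm, h⟩ := h
  refine ⟨_, (((PolyBounded.const 2).mul hm).add (.const 1)), fun i => ?_⟩
  have h₁ := (h i).key_le _ (List.mem_singleton_self _)
  have h₂ := (h i).cur_le _ (List.mem_singleton_self _)
  refine ⟨by simp, by simp [Entry.close]; omega, by simp [Entry.close], ?_⟩
  exact (h i).total_lt.trans_le (Nat.pow_le_pow_right two_pos (by omega))

end PolyTame

section Algorithm

variable {𝕜 : Type} [Field 𝕜] {size : 𝕜 → ℕ} {ι : Type*} {N : ι → ℕ}
  {c : ι → Datum 𝕜} {E : ∀ i, Entry (N i)} {L : ∀ i, List (Entry (N i))}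
  {B : ι → ℕ} {v : ∀ i, Fin (N i)} {b : ι → Bool}

theorem IsArithmeticSize.rootBounded_value {ι : Type*} {N : ι → ℕ} (hz : IsArithmeticSize size)
    (o : ι → Option Bool) : RootBounded size N fun i => encodeValue (o i) := by
  refine (PolyBounded.const 2).mono fun i => ?_
  have h₀ := hz.natCast_le 0
  have h₁ := hz.natCast_le 1
  simp only [Nat.cast_zero, Nat.size_zero, Nat.cast_one, Nat.size_one] at h₀ h₁
  change (encodeValue (o i)).rootCost size ≤ 2
  generalize o i = x
  rcases x with _ | _ | _
  · simp [encodeValue]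
  · simpa [encodeValue, encodeBit] using h₀.trans one_le_two
  · simpa [encodeValue, encodeBit] using h₁

variable [LinearOrder 𝕜]

theorem PolyTime.bit {ι : Type*} {N : ι → ℕ} {c : ι → Datum 𝕜} (hc : RootBounded size N c)
    (b : Bool) : PolyTime size N c fun _ => encodeBit b := by
  cases b
  · simpa [encodeBit] using PolyTime.zero hc
  · simpa [encodeBit] using PolyTime.lit hc 1

theorem PolyTime.entry_key (hz : IsArithmeticSize size)
    (hE : PolyTime size N c fun i => encodeEntry (E i)) (hT : PolyTame N fun i => [E i]) :
    PolyTime size N c fun i => .num ((E i).key : 𝕜) :=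
  hE.fst (hz.rootBounded_natCast hT.key.natSize)

theorem PolyTime.entry_cur (hz : IsArithmeticSize size)
    (hE : PolyTime size N c fun i => encodeEntry (E i)) (hT : PolyTame N fun i => [E i]) :
    PolyTime size N c fun i => .num ((E i).cur : 𝕜) :=
  (hE.snd .cons).fst (hz.rootBounded_natCast hT.cur.natSize)

theorem PolyTime.entry_cnt (hz : IsArithmeticSize size)
    (hE : PolyTime size N c fun i => encodeEntry (E i)) (hT : PolyTame N fun i => [E i]) :
    PolyTime size N c fun i => .num ((E i).cnt : 𝕜) :=
  ((hE.snd .cons).snd .cons).fst (hz.rootBounded_natCast hT.cnt_size)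

theorem PolyTime.entry_asg (hE : PolyTime size N c fun i => encodeEntry (E i)) :
    PolyTime size N c fun i => encodeList (List.ofFn fun v => encodeValue ((E i).asg v)) :=
  ((hE.snd .cons).snd .cons).snd (.encodeList _)

theorem PolyTime.entry_mk {key cur cnt : ι → ℕ} {asg : ∀ i, Fin (N i) → Option Bool}
    (h₁ : PolyTime size N c fun i => .num (key i : 𝕜))
    (h₂ : PolyTime size N c fun i => .num (cur i : 𝕜))
    (h₃ : PolyTime size N c fun i => .num (cnt i : 𝕜))
    (h₄ : PolyTime size N c fun i => encodeList (List.ofFn fun v => encodeValue (asg i v))) :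
    PolyTime size N c fun i => encodeEntry (⟨key i, cur i, cnt i, asg i⟩ : Entry (N i)) :=
  h₁.cons (h₂.cons (h₃.cons h₄))

variable [IsStrictOrderedRing 𝕜]

theorem PolyTime.entry_extend (hz : IsArithmeticSize size)
    (hE : PolyTime size N c fun i => encodeEntry (E i)) (hT : PolyTame N fun i => [E i])
    (hB : PolyTime size N c fun i => .num (B i : 𝕜)) (hB' : PolyBounded N B)
    (hv : PolyTime size N c fun i => .num ((v i : ℕ) : 𝕜))
    (hb : PolyTime size N c fun i => encodeBit (b i)) :
    PolyTime size N c fun i => encodeEntry ((E i).extend (B i) (v i) (b i)) := by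
  have hcur := hE.entry_cur hz hT
  have hc := hE.rootBounded_left
  refine PolyTime.entry_mk (hE.entry_key hz hT) ?_ (hE.entry_cnt hz hT) ?_
  · have hd : PolyBounded N fun i => if b i then B i else 1 :=
      (hB'.add (.const 1)).mono fun i => by split_ifs <;> omega
    refine (hcur.natMul hz hcur (hT.cur.mul hT.cur).natSize).natMul hz ?_
      ((hT.cur.mul hT.cur).mul hd).natSize
    refine PolyTime.ite_natEq (a := fun _ => 1) (b := fun i => if b i then 1 else 0)
      (p := fun i => b i = true) (.lit hc 1) (by simpa [encodeBit] using hb) (fun i => ?_) ?_ ?_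
    · cases b i <;> simp
    · have e : ∀ i : {i // b i = true}, (if b i.1 then B i.1 else 1) = B i.1 := fun i => if_pos i.2
      simp only [e]
      exact hB.comap _
    · have e : ∀ i : {i // ¬ b i = true}, (if b i.1 then B i.1 else 1) = 1 := fun i => if_neg i.2
      simp only [e]
      exact .lit (hc.comap _) 1
  · have e : ∀ i, (fun u => encodeValue (𝕜 := 𝕜) (Function.update (E i).asg (v i) (some (b i)) u)) =
        Function.update (fun u => encodeValue ((E i).asg u)) (v i) (encodeBit (b i)) := by
      intro i
      funext u
      rw [Function.apply_update fun _ => encodeValue]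
      rfl
    simp only [e]
    exact hE.entry_asg.updateFin hz .self (hz.rootBounded_value _) hv hb

theorem PolyTime.append_children (hz : IsArithmeticSize size)
    (hE : PolyTime size N c fun i => encodeEntry (E i)) (hT : PolyTame N fun i => [E i])
    (hB : PolyTime size N c fun i => .num (B i : 𝕜)) (hB' : PolyBounded N B)
    (hv : PolyTime size N c fun i => .num ((v i : ℕ) : 𝕜))
    (hL : PolyTime size N c fun i => encodeTable (L i)) :
    PolyTime size N c fun i => encodeTable ((E i).children (B i) (v i) ++ L i) := by
  have hget := hE.entry_asg.getFin hz .self (hz.rootBounded_value _) hv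
  refine PolyTime.ite_isNum (p := fun i => ∃ b, (E i).asg (v i) = some b) hget (fun i => ?_) ?_ ?_
  · rcases (E i).asg (v i) with _ | b
    · simp [encodeValue]
    · simp [encodeValue, encodeBit]
  · choose b hb using fun i : {i // ∃ b, (E i).asg (v i) = some b} => i.2
    have e : ∀ i : {i // ∃ b, (E i).asg (v i) = some b},
        (E i.1).children (B i.1) (v i.1) = [(E i.1).extend (B i.1) (v i.1) (b i)] := by
      intro i
      unfold Entry.children
      rw [hb i]
    have hget' := hget.comap fun i : {i // ∃ b, (E i).asg (v i) = some b} => i.1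
    simp only [hb] at hget'
    simp only [e]
    exact ((hE.comap _).entry_extend hz (hT.comap _) (hB.comap _) (hB'.comap _) (hv.comap _)
      hget').cons (hL.comap _)
  · have e : ∀ i : {i // ¬ ∃ b, (E i).asg (v i) = some b},
        (E i.1).children (B i.1) (v i.1) =
          [(E i.1).extend (B i.1) (v i.1) false, (E i.1).extend (B i.1) (v i.1) true] := by
      intro i
      unfold Entry.children
      split
      · rename_i b hb
        exact absurd ⟨b, hb⟩ i.2
      · rfl
    have hx : ∀ b : Bool, PolyTime size (fun i : {i // ¬ ∃ b, (E i).asg (v i) = some b} => N i)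
        (fun i => c i) fun i => encodeEntry ((E i.1).extend (B i.1) (v i.1) b) := fun b =>
      (hE.comap _).entry_extend hz (hT.comap _) (hB.comap _) (hB'.comap _) (hv.comap _)
        (.bit (hB.rootBounded_left.comap _) b)
    simp only [e]
    exact (hx false).cons ((hx true).cons (hL.comap _))

theorem PolyTime.branchVar (hz : IsArithmeticSize size)
    (hL : PolyTime size N c fun i => encodeTable (L i)) (hT : PolyTame N L)
    (hB : PolyTime size N c fun i => .num (B i : 𝕜)) (hB' : PolyBounded N B)
    (hv : PolyTime size N c fun i => .num ((v i : ℕ) : 𝕜)) :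
    PolyTime size N c fun i => encodeTable (branchVar (B i) (L i) (v i)) := by
  refine PolyTime.foldl (encA := fun i => encodeEntry) (encS := fun i => encodeTable) hL hT.length
    .cons (.nil hL.rootBounded_left) ?_
  let φ : (Σ i, Stage (L i)) → ι := Sigma.fst
  refine PolyTime.append_children hz ((PolyTime.cons_snd .cons).comp (.cons_snd .cons)) ?_
    (hB.lift φ) (hB'.comap φ) (hv.lift φ)
    ((PolyTime.cons_snd .cons).comp (.cons_fst (.encodeList _)))
  exact (hT.comap φ).singleton fun q => q.2.mem

theorem PolyTime.branchBlock (hz : IsArithmeticSize size) {w : ℕ}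
    (hL : PolyTime size N c fun i => encodeTable (L i)) (hT : PolyTame N L)
    (hcur : ∀ i, ∀ E ∈ L i, E.cur = 1)
    (hB : PolyTime size N c fun i => .num (B i : 𝕜)) (hB' : PolyBounded N B) (hpos : ∀ i, 0 < B i)
    {l : ∀ i, List (Fin (N i))} (hl : PolyTime size N c fun i => encodeBlock (l i))
    (hw : ∀ i, (l i).length ≤ w) :
    PolyTime size N c (fun i => encodeTable (branchBlock (B i) (L i) (l i))) ∧
      PolyTame N fun i => branchBlock (B i) (L i) (l i) := by
  have hT₀ := hT
  obtain ⟨m, hm, hT'⟩ := hT₀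
  have hbound : PolyBounded N fun i => 2 ^ w * m i + m i + w + B i ^ 2 ^ w :=
    ((((PolyBounded.const _).mul hm).add hm).add (.const w)).add (hB'.pow _)
  refine ⟨?_, _, hbound, fun i => tame_branchBlock (hpos i) (hcur i) (hT' i) _ (hw i)⟩
  let φ : (Σ i, Stage (l i)) → ι := Sigma.fst
  have hvar : RootBounded size (fun q : Σ i, Stage (l i) => N q.1)
      fun q => .num ((q.2.1.2 : ℕ) : 𝕜) :=
    hz.rootBounded_natCast
      ((PolyBounded.self (N := N).comap φ).mono fun q => q.2.1.2.isLt.le).natSize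
  refine PolyTime.foldl (encA := fun i (u : Fin (N i)) => .num ((u : ℕ) : 𝕜))
    (encS := fun i => encodeTable) hl ((PolyBounded.const w).mono hw) hvar hL ?_
  refine PolyTime.branchVar hz ((PolyTime.cons_snd .cons).comp (.cons_fst (.encodeList _))) ?_
    (hB.lift φ) (hB'.comap φ) ((PolyTime.cons_snd .cons).comp (.cons_snd hvar))
  exact ⟨_, hbound.comap φ, fun q => tame_branchBlock (hpos _) (hcur _) (hT' _) _
    (q.2.length_lt.le.trans (hw _))⟩

theorem PolyTime.merge (hz : IsArithmeticSize size)
    (hL : PolyTime size N c fun i => encodeTable (L i)) (hT : PolyTame N L)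
    (hE : PolyTime size N c fun i => encodeEntry (E i)) (hTE : PolyTame N fun i => [E i]) :
    PolyTime size N c fun i => encodeTable (merge (L i) (E i)) := by
  -- A count never exceeds the counts of the whole table and of the inserted entry together.
  have hbound : ∀ q : Σ i, Stage (L i),
      (((q.2.1.1.foldl mergeStep (E q.1, [])).1.cnt) + q.2.1.2.cnt).size ≤
        (E q.1).cnt.size + ((total (L q.1)).size + (total (L q.1)).size) := by
    intro q
    have h₁ : total (q.2.1.1.filter fun E' => E'.key = (E q.1).key) ≤ total (L q.1) := by
      obtain ⟨r, hr⟩ := q.2.2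
      have hs : List.Sublist q.2.1.1 (L q.1) := by
        conv_rhs => rw [hr]
        exact List.sublist_append_left _ _
      exact ((List.filter_sublist.trans hs).map _).sum_le_sum fun _ _ => Nat.zero_le _
    have h₂ : q.2.1.2.cnt ≤ total (L q.1) :=
      List.single_le_sum (fun _ _ => Nat.zero_le _) _ (List.mem_map_of_mem q.2.mem)
    rw [foldl_mergeStep]
    dsimp only
    rw [add_assoc]
    refine (natSize_add_le _ _).trans (Nat.add_le_add_left ?_ _)
    exact (natSize_add_le _ _).trans
      (add_le_add (Nat.size_le_size h₁) (Nat.size_le_size h₂))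
  let φ : (Σ i, Stage (L i)) → ι := Sigma.fst
  have hbound' : PolyBounded (fun q : Σ i, Stage (L i) => N q.1) fun q =>
      (E q.1).cnt.size + ((total (L q.1)).size + (total (L q.1)).size) :=
    (hTE.cnt_size.add (hT.total_size.add hT.total_size)).comap φ
  have hitem : PolyTame (fun q : Σ i, Stage (L i) => N q.1) fun q => [q.2.1.2] :=
    (hT.comap φ).singleton fun q => q.2.mem
  have hkey : ∀ q : Σ i, Stage (L i),
      (q.2.1.1.foldl mergeStep (E q.1, [])).1.key = (E q.1).key := fun q => by
    rw [foldl_mergeStep]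
  have hcur : ∀ q : Σ i, Stage (L i),
      (q.2.1.1.foldl mergeStep (E q.1, [])).1.cur = (E q.1).cur := fun q => by
    rw [foldl_mergeStep]
  refine PolyTime.foldl (encA := fun i => encodeEntry)
    (σ := fun i => Entry (N i) × List (Entry (N i))) (step := fun _ => mergeStep)
    (encS := fun _ q => .cons (encodeEntry q.1) (encodeTable q.2)) (init := fun i => (E i, []))
    hL hT.length .cons (hE.cons (.nil hL.rootBounded_left)) ?_
  have h₁ := PolyTime.cons_snd (size := size) (N := fun q : Σ i, Stage (L i) => N q.1)
    (f := fun q => c q.1)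
    (g := fun q => .cons (.cons (encodeEntry (q.2.1.1.foldl mergeStep (E q.1, [])).1)
      (encodeTable (q.2.1.1.foldl mergeStep (E q.1, [])).2)) (encodeEntry q.2.1.2)) .cons
  have h₂ := h₁.snd .cons
  have h₃ := h₁.fst .cons
  have h₄ := h₃.fst .cons
  have h₅ := h₃.snd (.encodeList _)
  have hstate : PolyTame (fun q : Σ i, Stage (L i) => N q.1)
      fun q => [(q.2.1.1.foldl mergeStep (E q.1, [])).1] := by
    refine ⟨_, ((((hTE.key.add hTE.cur).comap φ).add hbound').add (.const 1)), fun q =>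
      ⟨by simp, ?_, ?_, ?_⟩⟩
    · simp only [List.mem_singleton, forall_eq, hkey, φ]
      omega
    · simp only [List.mem_singleton, forall_eq, hcur, φ]
      omega
    · have := (Nat.size_le_size (Nat.le_add_right _ _)).trans (hbound q)
      simp only [total, List.map_cons, List.map_nil, List.sum_cons, List.sum_nil, add_zero]
      refine (Nat.lt_size_self _).trans_le (Nat.pow_le_pow_right two_pos ?_)
      simp only [total] at this
      omega
  refine PolyTime.ite_natEq (p := fun q : Σ i, Stage (L i) =>
    q.2.1.2.key = (q.2.1.1.foldl mergeStep (E q.1, [])).1.key)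
    (h₂.entry_key hz hitem) (h₄.entry_key hz hstate) (fun q => Iff.rfl) ?_ ?_
  · have h₆ := (PolyTime.entry_mk (h₄.entry_key hz hstate) (h₄.entry_cur hz hstate)
      ((h₄.entry_cnt hz hstate).natAdd hz (h₂.entry_cnt hz hitem) (hbound'.mono hbound))
      h₄.entry_asg).cons h₅
    have h₇ := h₆.comap (Subtype.val : {q : Σ i, Stage (L i) //
      q.2.1.2.key = (q.2.1.1.foldl mergeStep (E q.1, [])).1.key} → _)
    refine Eq.mp ?_ h₇
    congr 1
    funext q
    simp only [mergeStep, if_pos q.2]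
  · have h₇ := (h₄.cons (h₂.cons h₅)).comap (Subtype.val : {q : Σ i, Stage (L i) //
      ¬ q.2.1.2.key = (q.2.1.1.foldl mergeStep (E q.1, [])).1.key} → _)
    refine Eq.mp ?_ h₇
    congr 1
    funext q
    simp only [mergeStep, if_neg q.2]
    rfl

theorem PolyTime.mergeAll (hz : IsArithmeticSize size)
    (hL : PolyTime size N c fun i => encodeTable (L i)) (hT : PolyTame N L) :
    PolyTime size N c fun i => encodeTable (mergeAll (L i)) := by
  let φ : (Σ i, Stage (L i)) → ι := Sigma.fst
  have hitem : PolyTame (fun q : Σ i, Stage (L i) => N q.1) fun q => [q.2.1.2] :=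
    (hT.comap φ).singleton fun q => q.2.mem
  refine PolyTime.foldl (encA := fun i => encodeEntry) (encS := fun i => encodeTable) hL hT.length
    .cons (.nil hL.rootBounded_left) ?_
  have h₁ := PolyTime.cons_snd (size := size) (N := fun q : Σ i, Stage (L i) => N q.1)
    (f := fun q => c q.1)
    (g := fun q => .cons (encodeTable (Exch.mergeAll q.2.1.1)) (encodeEntry q.2.1.2)) .cons
  have h₂ := h₁.snd .cons
  have hclose := PolyTime.entry_mk
    ((h₂.entry_key hz hitem).natAdd hz (h₂.entry_cur hz hitem)
      (hitem.key.add hitem.cur).natSize)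
    (.lit h₁.rootBounded_left 1) (h₂.entry_cnt hz hitem) h₂.entry_asg
  refine PolyTime.merge hz (h₁.fst (.encodeList _)) ?_ hclose hitem.close
  obtain ⟨m, hm, hT⟩ := hT
  refine ⟨_, ((((PolyBounded.const 2).mul hm).add (.const 1)).comap φ), fun q => ?_⟩
  obtain ⟨r, hr⟩ := q.2.2
  refine tame_mergeAll ((hT q.1).of_sublist ?_)
  conv_rhs => rw [hr]
  exact List.sublist_append_left _ _

theorem PolyTime.table (hz : IsArithmeticSize size) {w : ℕ} {e : ∀ i, Fin (N i) → Option Bool}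
    {bs : ∀ i, List (List (Fin (N i)))}
    (he : PolyTime size N c fun i => encodeList (List.ofFn fun v => encodeValue (e i v)))
    (hB : PolyTime size N c fun i => .num (B i : 𝕜)) (hB' : PolyBounded N B) (hpos : ∀ i, 0 < B i)
    (hbs : PolyTime size N c fun i => encodeList ((bs i).map encodeBlock))
    (hlen : PolyBounded N fun i => (bs i).length) (hw : ∀ i, ∀ l ∈ bs i, l.length ≤ w) :
    PolyTime size N c (fun i => encodeTable (table (B i) (e i) (bs i))) ∧
      PolyTame N fun i => table (B i) (e i) (bs i) := by
  have hbound : PolyBounded N fun i => (bs i).length * B i ^ 2 ^ w + w * (bs i).length + 1 :=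
    ((hlen.mul (hB'.pow _)).add ((PolyBounded.const w).mul hlen)).add (.const 1)
  refine ⟨?_, _, hbound, fun i => tame_table (hpos i) _ _ (hw i)⟩
  let φ : (Σ i, Stage (bs i)) → ι := Sigma.fst
  have hc := he.rootBounded_left
  refine PolyTime.foldl (encA := fun i => encodeBlock) (encS := fun i => encodeTable) hbs
    hlen (.encodeList _) (PolyTime.cons (.entry_mk (key := fun _ => 0) (cur := fun _ => 1)
      (cnt := fun _ => 1) (.lit hc 0) (.lit hc 1) (.lit hc 1) he) (.nil hc)) ?_
  have hw' : ∀ q : Σ i, Stage (bs i), ∀ l ∈ q.2.1.1, l.length ≤ w := fun q l hl =>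
    hw q.1 l (q.2.mem_of_mem hl)
  have hT : PolyTame (fun q : Σ i, Stage (bs i) => N q.1)
      fun q => Exch.table (B q.1) (e q.1) q.2.1.1 := by
    refine ⟨_, hbound.comap φ, fun q => (tame_table (hpos _) _ _ (hw' q)).mono ?_⟩
    have := q.2.length_lt.le
    dsimp only [φ]
    gcongr
  obtain ⟨h₁, h₂⟩ := PolyTime.branchBlock (w := w) hz
    ((PolyTime.cons_snd .cons).comp (.cons_fst (.encodeList _))) hT
    (fun q E hE => ((table_bounds (hpos _) _ _ (hw' q)).2.2 E hE).1) (hB.lift φ) (hB'.comap φ)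
    (fun q => hpos _) ((PolyTime.cons_snd .cons).comp (.cons_snd (.encodeList _)))
    fun q => hw _ _ q.2.mem
  exact h₁.mergeAll hz h₂

end Algorithm

/-! ### Correctness of the table -/

section Correctness

variable {n : ℕ} {B : ℕ}

/-- The value of `Entry.cur` after the variables in `l` got their values from `x`, starting
with `m`. -/
def weight (B : ℕ) (x : Fin n → Bool) (m : ℕ) (l : List (Fin n)) : ℕ :=
  l.foldl (fun m v => m * m * if x v then B else 1) m

/-- The key of a full assignment: it counts how often each bit string is assigned to a block. -/
def fullKey (B : ℕ) (bs : List (List (Fin n))) (x : Fin n → Bool) : ℕ :=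
  (bs.map (weight B x 1)).sum

/-- `y` is a completion of `e` that assigns exactly the variables in `S` in addition. -/
structure Completes (e : Fin n → Option Bool) (S : List (Fin n)) (y : Fin n → Option Bool) :
    Prop where
  isSome : ∀ v ∈ S, ∃ b, y v = some b
  eq : ∀ v, v ∉ S → y v = e v
  of_eq_some : ∀ v b, e v = some b → y v = some b

/-- The sum of `G` over the full assignments that extend `y`. -/
def sumExtends {R : Type*} [AddCommMonoid R] (G : (Fin n → Bool) → R) (y : Fin n → Option Bool) :
    R :=
  ∑ x : Fin n → Bool with Extends x y, G x

theorem extends_update_iff {x : Fin n → Bool} {y : Fin n → Option Bool} {v : Fin n} {b : Bool}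
    (h : ∀ b', y v = some b' → b' = b) :
    Extends x (Function.update y v (some b)) ↔ Extends x y ∧ x v = b := by
  constructor
  · intro hx
    have hv : x v = b := hx v b (by simp)
    refine ⟨fun u b' hu => ?_, hv⟩
    rcases eq_or_ne u v with rfl | hne
    · rw [hv, h b' hu]
    · exact hx u b' (by rwa [Function.update_of_ne hne])
  · rintro ⟨hx, hv⟩ u b' hu
    rcases eq_or_ne u v with rfl | hne
    · rw [Function.update_self, Option.some.injEq] at hu
      rw [hv, hu]
    · exact hx u b' (by rwa [Function.update_of_ne hne] at hu)

theorem sumExtends_update_add {R : Type*} [AddCommMonoid R] (G : (Fin n → Bool) → R)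
    {y : Fin n → Option Bool} {v : Fin n} (hv : y v = none) :
    sumExtends G (Function.update y v (some false)) +
      sumExtends G (Function.update y v (some true)) = sumExtends G y := by
  have h : ∀ b, ∀ b', y v = some b' → b' = b := by simp [hv]
  simp only [sumExtends, extends_update_iff (h _)]
  rw [← Finset.sum_filter_add_sum_filter_not (s := {x | Extends x y}) (p := fun x => x v = false),
    Finset.filter_filter, Finset.filter_filter]
  simp

/-- Two completions of `e` that assign the same variables have equally many full extensions, and
corresponding ones agree outside of these variables. -/
theorem Completes.sumExtends_eq {R : Type*} [AddCommMonoid R] {e y y' : Fin n → Option Bool}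
    {S : List (Fin n)} (h : Completes e S y) (h' : Completes e S y') (G : (Fin n → Bool) → R)
    (hG : ∀ x x' : Fin n → Bool, Extends x y → Extends x' y' → (∀ v, v ∉ S → x v = x' v) →
      G x = G x') :
    sumExtends G y = sumExtends G y' := by
  have key : ∀ y y' : Fin n → Option Bool, Completes e S y → Completes e S y' →
      ∀ x : Fin n → Bool, Extends x y →
        Extends (fun v => (if v ∈ S then y' v else none).getD (x v)) y' := by
    intro y y' h h' x hx v b hv
    dsimp only
    split_ifs with hS
    · rw [hv]
      rfl
    · rw [h'.eq v hS, ← h.eq v hS] at hv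
      exact hx v b hv
  have inv : ∀ y y' : Fin n → Option Bool, Completes e S y → Completes e S y' →
      ∀ x : Fin n → Bool, Extends x y → (fun v => (if v ∈ S then y v else none).getD
        ((if v ∈ S then y' v else none).getD (x v))) = x := by
    intro y y' h h' x hx
    funext v
    split_ifs with hS
    · obtain ⟨b, hb⟩ := h.isSome v hS
      rw [hb, hx v b hb]
      rfl
    · rfl
  refine Finset.sum_nbij' (fun x v => (if v ∈ S then y' v else none).getD (x v))
    (fun x v => (if v ∈ S then y v else none).getD (x v)) ?_ ?_ ?_ ?_ ?_
  · intro x hx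
    simp only [Finset.mem_filter, Finset.mem_univ, true_and] at hx ⊢
    exact key y y' h h' x hx
  · intro x hx
    simp only [Finset.mem_filter, Finset.mem_univ, true_and] at hx ⊢
    exact key y' y h' h x hx
  · intro x hx
    simp only [Finset.mem_filter, Finset.mem_univ, true_and] at hx
    exact inv y y' h h' x hx
  · intro x hx
    simp only [Finset.mem_filter, Finset.mem_univ, true_and] at hx
    exact inv y' y h' h x hx
  · intro x hx
    simp only [Finset.mem_filter, Finset.mem_univ, true_and] at hx
    exact hG _ _ hx (key y y' h h' x hx) fun v hv => by simp [hv]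

/-- The state of an entry for which the variables in `S` have been processed, while `l` is left
of the current block and the blocks in `bs` are still to come: `K x` is the full key of `x`. -/
structure Entry.Valid (B : ℕ) (K : (Fin n → Bool) → ℕ) (e : Fin n → Option Bool)
    (S l : List (Fin n)) (bs : List (List (Fin n))) (E : Entry n) : Prop where
  completes : Completes e S E.asg
  key_eq : ∀ x, Extends x E.asg → K x = E.key + weight B x E.cur l + fullKey B bs x

variable {K : (Fin n → Bool) → ℕ} {e : Fin n → Option Bool} {S l : List (Fin n)}
  {bs : List (List (Fin n))} {v : Fin n}

theorem Entry.Valid.children {E E' : Entry n} (h : E.Valid B K e S (v :: l) bs)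
    (hE' : E' ∈ E.children B v) : E'.Valid B K e (S ++ [v]) l bs := by
  obtain ⟨b, rfl, hb⟩ := Entry.eq_extend_of_mem_children hE'
  obtain ⟨h₁, h₂⟩ := h
  refine ⟨⟨fun u hu => ?_, fun u hu => ?_, fun u b' hu => ?_⟩, fun x hx => ?_⟩
  · rcases eq_or_ne u v with rfl | hne
    · exact ⟨b, by simp [Entry.extend]⟩
    · simpa [Entry.extend, hne] using h₁.isSome u (by simpa [hne] using hu)
  · simp only [List.mem_append, List.mem_singleton, not_or] at hu
    simpa [Entry.extend, hu.2] using h₁.eq u hu.1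
  · rcases eq_or_ne u v with rfl | hne
    · simp [Entry.extend, hb b' (h₁.of_eq_some u b' hu)]
    · simpa [Entry.extend, hne] using h₁.of_eq_some u b' hu
  · obtain ⟨hx, hv⟩ := (extends_update_iff hb).1 hx
    rw [h₂ x hx]
    simp [weight, Entry.extend, hv]

/-- Weighted sums over the full assignments that are represented by a table. -/
def tableSum {R : Type*} [CommSemiring R] (G : (Fin n → Bool) → R) (L : List (Entry n)) : R :=
  (L.map fun E => (E.cnt : R) * sumExtends G E.asg).sum

theorem tableSum_branchVar {R : Type*} [CommSemiring R] (G : (Fin n → Bool) → R)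
    (L : List (Entry n)) (v : Fin n) : tableSum G (branchVar B L v) = tableSum G L := by
  rw [tableSum, sum_branchVar, tableSum]
  congr 1
  refine List.map_congr_left fun E _ => ?_
  unfold Entry.children
  split
  · rename_i b hb
    have : Function.update E.asg v (some b) = E.asg := by rw [← hb, Function.update_eq_self]
    simp [Entry.extend, this]
  · rename_i hb
    simp only [Entry.extend, List.map_cons, List.map_nil, List.sum_cons, List.sum_nil, add_zero]
    rw [← mul_add, sumExtends_update_add G hb]

theorem branchBlock_valid {R : Type*} [CommSemiring R] (G : (Fin n → Bool) → R)
    {L : List (Entry n)} (h : ∀ E ∈ L, E.Valid B K e S l bs) :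
    (∀ E ∈ branchBlock B L l, E.Valid B K e (S ++ l) [] bs) ∧
      tableSum G (branchBlock B L l) = tableSum G L := by
  induction l generalizing S L with
  | nil => simpa [branchBlock] using h
  | cons v l ih =>
    have h' : ∀ E ∈ branchVar B L v, E.Valid B K e (S ++ [v]) l bs := by
      intro E hE
      obtain ⟨E', hE', hE⟩ := mem_branchVar.1 hE
      exact (h E' hE').children hE
    obtain ⟨h₁, h₂⟩ := ih h'
    rw [List.append_assoc] at h₁
    exact ⟨h₁, h₂.trans (tableSum_branchVar G L v)⟩

theorem weight_congr {x x' : Fin n → Bool} (h : ∀ v ∈ l, x v = x' v) (m : ℕ) :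
    weight B x m l = weight B x' m l := by
  unfold weight
  induction l generalizing m with
  | nil => rfl
  | cons v l ih =>
    rw [List.foldl_cons, List.foldl_cons, h v (by simp)]
    exact ih (fun u hu => h u (by simp [hu])) _

theorem fullKey_congr {x x' : Fin n → Bool} (h : ∀ l ∈ bs, ∀ v ∈ l, x v = x' v) :
    fullKey B bs x = fullKey B bs x' := by
  unfold fullKey
  congr 1
  exact List.map_congr_left fun l hl => weight_congr (h l hl) 1

/-- Entries with equal keys may be united because their completions occur in pairs with equal
full keys. -/
theorem mergeAll_valid {R : Type*} [CommSemiring R] (F : ℕ → R) {L : List (Entry n)}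
    (h : ∀ E ∈ L, E.Valid B K e S [] bs) (hS : ∀ l ∈ bs, ∀ v ∈ l, v ∉ S) :
    (∀ E ∈ mergeAll L, E.cur = 1 ∧ Completes e S E.asg ∧
      ∀ x, Extends x E.asg → K x = E.key + fullKey B bs x) ∧
      tableSum (fun x => F (K x)) (mergeAll L) = tableSum (fun x => F (K x)) L := by
  have h' : ∀ {L : List (Entry n)}, (∀ E ∈ L, E.Valid B K e S [] bs) → ∀ E ∈ mergeAll L,
      E.cur = 1 ∧ Completes e S E.asg ∧ ∀ x, Extends x E.asg → K x = E.key + fullKey B bs x := by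
    intro L h E hE
    obtain ⟨E', hE', hk, hc, ha⟩ := mem_mergeAll hE
    rw [hk, hc, ha]
    exact ⟨rfl, (h E' hE').completes, (h E' hE').key_eq⟩
  refine ⟨h' h, ?_⟩
  induction L using List.reverseRecOn with
  | nil => rfl
  | append_singleton L E ih =>
    have hL : ∀ E ∈ L, E.Valid B K e S [] bs := fun E hE => h E (by simp [hE])
    have hE : E.Valid B K e S [] bs := h E (by simp)
    rw [mergeAll_concat, tableSum, sum_merge, tableSum, List.map_append, List.sum_append]
    · have := ih hL
      unfold tableSum at this
      rw [this]
      simp [Entry.close]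
    · intro E' hE' hkey
      obtain ⟨-, h₁, h₂⟩ := h' hL E' hE'
      refine h₁.sumExtends_eq hE.completes _ fun x x' hx hx' hxx => ?_
      rw [h₂ x hx, hE.key_eq x' hx', hkey, fullKey_congr fun l hl v hv => hxx v (hS l hl v hv)]
      rfl

theorem foldl_stepBlock_valid {R : Type*} [CommSemiring R] (F : ℕ → R) {L : List (Entry n)}
    (hS : (S ++ bs.flatten).Nodup)
    (h : ∀ E ∈ L, E.cur = 1 ∧ Completes e S E.asg ∧
      ∀ x, Extends x E.asg → K x = E.key + fullKey B bs x) :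
    (∀ E ∈ bs.foldl (stepBlock B) L, Completes e (S ++ bs.flatten) E.asg ∧
      ∀ x, Extends x E.asg → K x = E.key) ∧
      tableSum (fun x => F (K x)) (bs.foldl (stepBlock B) L) =
        tableSum (fun x => F (K x)) L := by
  induction bs generalizing S L with
  | nil => simpa [fullKey] using fun E hE => (h E hE).2
  | cons l bs ih =>
    rw [List.flatten_cons, ← List.append_assoc] at hS
    obtain ⟨h₁, h₂⟩ := branchBlock_valid (l := l) (bs := bs) (B := B) (K := K) (e := e) (S := S)
      (fun x => F (K x)) (L := L) fun E hE => by
        obtain ⟨hc, hE₁, hE₂⟩ := h E hE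
        refine ⟨hE₁, fun x hx => ?_⟩
        rw [hE₂ x hx, hc, fullKey, List.map_cons, List.sum_cons, add_assoc, fullKey]
    obtain ⟨h₃, h₄⟩ := mergeAll_valid F h₁ fun l' hl' v hv hvS =>
      (List.disjoint_of_nodup_append hS) hvS (List.mem_flatten.2 ⟨l', hl', hv⟩)
    obtain ⟨h₅, h₆⟩ := ih hS h₃
    rw [List.flatten_cons, ← List.append_assoc]
    exact ⟨h₅, h₆.trans (h₄.trans h₂)⟩

/-- The full assignment given by the values of a partial assignment. -/
def completion (y : Fin n → Option Bool) (v : Fin n) : Bool := (y v).getD false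

/-- The table represents every extension of the evidence, up to a change that preserves the full
key. -/
theorem table_spec {R : Type*} [CommSemiring R] (F : ℕ → R) (B : ℕ) (e : Fin n → Option Bool)
    (hnodup : bs.flatten.Nodup) (hmem : ∀ v, v ∈ bs.flatten) :
    (∀ E ∈ table B e bs, (∀ v, E.asg v = some (completion E.asg v)) ∧
      Extends (completion E.asg) e) ∧
      ((table B e bs).map fun E => (E.cnt : R) * F (fullKey B bs (completion E.asg))).sum =
        sumExtends (fun x => F (fullKey B bs x)) e := by
  obtain ⟨h₁, h₂⟩ := foldl_stepBlock_valid (K := fullKey B bs) (S := []) (e := e) F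
    (L := [Entry.start e]) (by simpa using hnodup) (by
      intro E hE
      rw [List.mem_singleton] at hE
      subst hE
      exact ⟨rfl, ⟨by simp, fun _ _ => rfl, fun _ _ h => h⟩, fun x _ => (Nat.zero_add _).symm⟩)
  have h₃ : ∀ E ∈ table B e bs, ∀ v, E.asg v = some (completion E.asg v) := by
    intro E hE v
    obtain ⟨b, hb⟩ := (h₁ E hE).1.isSome v (by simpa using hmem v)
    simp [completion, hb]
  refine ⟨fun E hE => ⟨h₃ E hE, fun v b hv => ?_⟩, ?_⟩
  · simp [completion, (h₁ E hE).1.of_eq_some v b hv]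
  · have h₄ : tableSum (fun x => F (fullKey B bs x)) [Entry.start e] =
        sumExtends (fun x => F (fullKey B bs x)) e := by
      simp [tableSum, Entry.start]
    rw [← h₄, ← h₂, tableSum]
    congr 1
    refine List.map_congr_left fun E hE => ?_
    have h₅ : ∀ x, Extends x E.asg ↔ x = completion E.asg := by
      intro x
      constructor
      · intro hx
        funext v
        exact hx v _ (h₃ E hE v)
      · rintro rfl v b hv
        simp [completion, hv]
    simp only [sumExtends, h₅]
    rw [Finset.sum_filter, Finset.sum_ite_eq' Finset.univ, if_pos (Finset.mem_univ _)]

/-! ### Keys and exchangeability -/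

/-- The number whose binary digits are given by a bit string, the digits of `a` going first. -/
def bitCode (a : ℕ) (s : List Bool) : ℕ := s.foldl (fun a b => 2 * a + b.toNat) a

theorem bitCode_injective {s s' : List Bool} (hlen : s.length = s'.length) {a a' : ℕ}
    (h : bitCode a s = bitCode a' s') : a = a' ∧ s = s' := by
  induction s generalizing s' a a' with
  | nil =>
    rw [List.length_nil, eq_comm, List.length_eq_zero_iff] at hlen
    subst hlen
    exact ⟨h, rfl⟩
  | cons b s ih =>
    cases s' with
    | nil => simp at hlen
    | cons b' s' =>
      have h' : bitCode (2 * a + b.toNat) s = bitCode (2 * a' + b'.toNat) s' := h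
      obtain ⟨h₁, h₂⟩ := ih (Nat.succ_injective hlen) h'
      have := b.toNat_le
      have := b'.toNat_le
      have h₃ : b.toNat = b'.toNat := by omega
      refine ⟨by omega, List.cons_eq_cons.2 ⟨?_, h₂⟩⟩
      revert h₃
      clear * -
      cases b <;> cases b' <;> decide

theorem weight_pow (x : Fin n → Bool) (a : ℕ) (l : List (Fin n)) :
    weight B x (B ^ a) l = B ^ bitCode a (l.map x) := by
  unfold weight bitCode
  induction l generalizing a with
  | nil => rfl
  | cons v l ih =>
    rw [List.foldl_cons, List.map_cons, List.foldl_cons, ← ih]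
    congr 1
    cases x v <;> simp [two_mul, pow_add]

theorem sum_mul_pow_injective {D : ℕ} {f g : ℕ → ℕ} (hf : ∀ d, f d < B) (hg : ∀ d, g d < B)
    (h : ∑ d ∈ Finset.range D, f d * B ^ d = ∑ d ∈ Finset.range D, g d * B ^ d) :
    ∀ d < D, f d = g d := by
  induction D generalizing f g with
  | zero => simp
  | succ D ih =>
    have e : ∀ f : ℕ → ℕ, ∑ d ∈ Finset.range (D + 1), f d * B ^ d =
        B * ∑ d ∈ Finset.range D, f (d + 1) * B ^ d + f 0 := by
      intro f
      rw [Finset.sum_range_succ', Finset.mul_sum, pow_zero, mul_one]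
      congr 1
      exact Finset.sum_congr rfl fun d _ => by ring
    rw [e, e] at h
    have h₀ : f 0 = g 0 := by
      have := congrArg (· % B) h
      simpa [Nat.mul_add_mod, Nat.mod_eq_of_lt (hf 0), Nat.mod_eq_of_lt (hg 0)] using this
    rw [h₀] at h
    have hB : 0 < B := (Nat.zero_le _).trans_lt (hf 0)
    have h₁ := ih (fun d => hf (d + 1)) (fun d => hg (d + 1))
      (Nat.eq_of_mul_eq_mul_left hB (Nat.add_right_cancel h))
    intro d hd
    cases d with
    | zero => exact h₀
    | succ d => exact h₁ d (by omega)

/-- If the base exceeds the number of summands, then a sum of powers determines the multiset of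
the exponents. -/
theorem exists_perm_of_sum_pow_eq {k : ℕ} (hk : k < B) (f g : Fin k → ℕ)
    (h : ∑ i, B ^ f i = ∑ i, B ^ g i) : ∃ π : Equiv.Perm (Fin k), ∀ i, f i = g (π i) := by
  have e : ∀ (f : Fin k → ℕ) (D : ℕ), (∀ i, f i < D) →
      ∑ i, B ^ f i = ∑ d ∈ Finset.range D, Fintype.card {i // f i = d} * B ^ d := by
    intro f D hD
    rw [← Finset.sum_fiberwise_of_maps_to (s := Finset.univ) (t := Finset.range D) (g := f)
      fun i _ => Finset.mem_range.2 (hD i)]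
    refine Finset.sum_congr rfl fun d _ => ?_
    rw [Fintype.card_subtype, Finset.sum_congr rfl (g := fun _ => B ^ d), Finset.sum_const,
      smul_eq_mul]
    intro i hi
    rw [(Finset.mem_filter.1 hi).2]
  have hcard : ∀ (f : Fin k → ℕ) (d : ℕ), Fintype.card {i // f i = d} < B := fun f d =>
    (Fintype.card_subtype_le _).trans_lt (by simpa using hk)
  let D := ∑ i, (f i + g i) + 1
  have hD : ∀ i, f i + g i < D := fun i => Nat.lt_succ_of_le <|
    Finset.single_le_sum (f := fun i => f i + g i) (fun _ _ => Nat.zero_le _) (Finset.mem_univ i)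
  have hf : ∀ i, f i < D := fun i => (Nat.le_add_right _ _).trans_lt (hD i)
  have hg : ∀ i, g i < D := fun i => (Nat.le_add_left _ _).trans_lt (hD i)
  rw [e f D hf, e g D hg] at h
  have h₁ := sum_mul_pow_injective (hcard f) (hcard g) h
  have h₂ : ∀ d, Fintype.card {i // f i = d} = Fintype.card {i // g i = d} := by
    intro d
    by_cases hd : d < D
    · exact h₁ d hd
    · have : IsEmpty {i // f i = d} := ⟨fun i => hd (i.2 ▸ hf i)⟩
      have : IsEmpty {i // g i = d} := ⟨fun i => hd (i.2 ▸ hg i)⟩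
      rw [Fintype.card_eq_zero, Fintype.card_eq_zero]
  let π : Equiv.Perm (Fin k) := (Equiv.sigmaFiberEquiv f).symm.trans
    ((Equiv.sigmaCongrRight fun d => Fintype.equivOfCardEq (h₂ d)).trans (Equiv.sigmaFiberEquiv g))
  refine ⟨π, fun i => ?_⟩
  exact ((Fintype.equivOfCardEq (h₂ (f i))) ⟨i, rfl⟩).2.symm

section Exchangeable

variable {𝕜 : Type} [Field 𝕜] [LinearOrder 𝕜] {D : Decomposition n} {μ : Distribution 𝕜 n}

/-- The list of the blocks of a decomposition. -/
def Decomposition.blocks (D : Decomposition n) : List (List (Fin n)) := List.ofFn D.block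

theorem Decomposition.IsExchangeable.prob_eq (h : D.IsExchangeable μ) {x x' : Fin n → Bool}
    (hx : fullKey (D.k + 1) D.blocks x = fullKey (D.k + 1) D.blocks x') :
    μ.prob x = μ.prob x' := by
  have e : ∀ x, fullKey (D.k + 1) D.blocks x =
      ∑ i, (D.k + 1) ^ bitCode 0 ((D.block i).map x) := by
    intro x
    rw [fullKey, Decomposition.blocks, List.map_ofFn, List.sum_ofFn]
    refine Finset.sum_congr rfl fun i _ => ?_
    rw [← weight_pow, pow_zero]
    rfl
  rw [e, e] at hx
  obtain ⟨π, hπ⟩ := exists_perm_of_sum_pow_eq (Nat.lt_succ_self _) _ _ hx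
  refine h.2 π x' x fun i => ?_
  exact (bitCode_injective (by simpa using h.1 i (π i)) (hπ i)).2

theorem Decomposition.mem_flatten_blocks (D : Decomposition n) (v : Fin n) :
    v ∈ D.blocks.flatten := by
  obtain ⟨i, hi, -⟩ := D.existsUnique_mem v
  exact List.mem_flatten.2 ⟨_, (List.mem_ofFn' _ _).2 ⟨i, rfl⟩, hi⟩

theorem Decomposition.nodup_flatten_blocks (D : Decomposition n) : D.blocks.flatten.Nodup := by
  rw [List.nodup_flatten]
  refine ⟨fun l hl => ?_, ?_⟩
  · obtain ⟨i, rfl⟩ := (List.mem_ofFn' _ _).1 hl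
    exact D.nodup i
  · rw [Decomposition.blocks, List.pairwise_ofFn]
    intro i j hij v hi hj
    exact hij.ne ((D.existsUnique_mem v).unique hi hj)

theorem Decomposition.k_le (D : Decomposition n) : D.k ≤ n := by
  have h : ∀ i, ∃ v, v ∈ D.block i := fun i => List.exists_mem_of_ne_nil _ (D.block_ne_nil i)
  choose f hf using h
  have hinj : Function.Injective f := fun i j hij =>
    (D.existsUnique_mem (f i)).unique (hf i) (hij ▸ hf j)
  simpa using Fintype.card_le_of_injective f hinj

theorem Decomposition.length_le_width (D : Decomposition n) :
    ∀ l ∈ D.blocks, l.length ≤ D.width := by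
  intro l hl
  obtain ⟨i, rfl⟩ := (List.mem_ofFn' _ _).1 hl
  exact Finset.le_sup (f := fun i => (D.block i).length) (Finset.mem_univ i)

/-- The table of an exchangeable decomposition, with a base that exceeds the number of blocks. -/
def Decomposition.table (D : Decomposition n) (e : Fin n → Option Bool) : List (Entry n) :=
  Exch.table (D.k + 1) e D.blocks

theorem Decomposition.asg_eq {e : Fin n → Option Bool} {E : Entry n} (hE : E ∈ D.table e)
    (v : Fin n) : E.asg v = some (completion E.asg v) :=
  ((table_spec (fun _ => (0 : ℕ)) _ e D.nodup_flatten_blocks D.mem_flatten_blocks).1 E hE).1 v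

theorem Decomposition.extends_completion {e : Fin n → Option Bool} {E : Entry n}
    (hE : E ∈ D.table e) : Extends (completion E.asg) e :=
  ((table_spec (fun _ => (0 : ℕ)) _ e D.nodup_flatten_blocks D.mem_flatten_blocks).1 E hE).2

theorem Decomposition.IsExchangeable.marginal_eq (h : D.IsExchangeable μ)
    (e : Fin n → Option Bool) :
    μ.marginal e = ((D.table e).map fun E => (E.cnt : 𝕜) * μ.prob (completion E.asg)).sum := by
  classical
  let F : ℕ → 𝕜 := fun κ =>
    if hκ : ∃ x, fullKey (D.k + 1) D.blocks x = κ then μ.prob hκ.choose else 0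
  have hF : ∀ x, F (fullKey (D.k + 1) D.blocks x) = μ.prob x := by
    intro x
    have hκ : ∃ x', fullKey (D.k + 1) D.blocks x' = fullKey (D.k + 1) D.blocks x := ⟨x, rfl⟩
    simp only [F, dif_pos hκ]
    exact h.prob_eq hκ.choose_spec
  have := (table_spec F (D.k + 1) e D.nodup_flatten_blocks D.mem_flatten_blocks).2
  simp only [hF] at this
  exact this.symm

theorem Decomposition.IsExchangeable.exists_mem_table (h : D.IsExchangeable μ)
    {e : Fin n → Option Bool} {x : Fin n → Bool} (hx : Extends x e) :
    ∃ E ∈ D.table e, μ.prob (completion E.asg) = μ.prob x := by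
  classical
  have hs := (table_spec (fun κ => if κ = fullKey (D.k + 1) D.blocks x then (1 : ℕ) else 0)
    (D.k + 1) e D.nodup_flatten_blocks D.mem_flatten_blocks).2
  have hpos : 0 < sumExtends (fun y => if fullKey (D.k + 1) D.blocks y =
      fullKey (D.k + 1) D.blocks x then (1 : ℕ) else 0) e :=
    Finset.sum_pos' (fun _ _ => Nat.zero_le _) ⟨x, by simpa using hx, by simp⟩
  rw [← hs] at hpos
  by_contra! hne
  refine hpos.ne' (List.sum_eq_zero fun m hm => ?_)
  obtain ⟨E, hE, rfl⟩ := List.mem_map.1 hm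
  rw [if_neg fun hk => hne E hE (h.prob_eq hk)]
  exact mul_zero _

end Exchangeable

end Correctness

/-! ### Inference -/

section Folds

variable {α β 𝕜 : Type*}

theorem foldl_add_eq_sum [Field 𝕜] (f : α → 𝕜) (l : List α) :
    l.foldl (fun s a => s + f a) 0 = (l.map f).sum := by
  rw [List.sum_eq_foldl, List.foldl_map]

/-- A left fold that keeps the better of the current and the next element finds a maximum. -/
theorem foldl_max_spec [Field 𝕜] [LinearOrder 𝕜] (f : α → 𝕜) (g : α → β)
    (hf : ∀ a, 0 ≤ f a) (b : β) (l : List α) :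
    (l = [] ∧ l.foldl (fun s a => if f a < s.1 then s else (f a, g a)) (0, b) = (0, b)) ∨
      ∃ a ∈ l, l.foldl (fun s a => if f a < s.1 then s else (f a, g a)) (0, b) = (f a, g a) ∧
        ∀ a' ∈ l, f a' ≤ f a := by
  induction l using List.reverseRecOn with
  | nil => exact .inl ⟨rfl, rfl⟩
  | append_singleton l a ih =>
    right
    rw [List.foldl_append, List.foldl_cons, List.foldl_nil]
    rcases ih with ⟨rfl, h⟩ | ⟨a', ha', h, hmax⟩
    · exact ⟨a, by simp, by simp [(hf a).not_gt], by simp⟩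
    · rw [h]
      by_cases hlt : f a < f a'
      · exact ⟨a', by simp [ha'], if_pos hlt, by simpa [or_imp, forall_and, hlt.le] using hmax⟩
      · refine ⟨a, by simp, if_neg hlt, ?_⟩
        simpa [or_imp, forall_and] using fun x hx => (hmax x hx).trans (not_lt.1 hlt)

end Folds

section Inference

variable {𝕜 : Type} [Field 𝕜]

theorem encodeDecomposition_eq {n : ℕ} (D : Decomposition n) :
    (encodeDecomposition D : Datum 𝕜) = encodeList (D.blocks.map encodeBlock) := by
  simp only [encodeDecomposition, Decomposition.blocks, List.map_ofFn]
  congr 2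
  funext i
  simp only [Function.comp_apply, encodeBlock]
  congr 1
  simp [← List.map_eq_flatMap]

theorem encodeAssignment_completion {n : ℕ} {y : Fin n → Option Bool}
    (h : ∀ v, y v = some (completion y v)) :
    encodeList (List.ofFn fun v => encodeValue (y v)) =
      (encodeAssignment (completion y) : Datum 𝕜) := by
  unfold encodeAssignment
  congr 2
  funext v
  rw [h v]
  rfl

variable [LinearOrder 𝕜] {size : 𝕜 → ℕ} {C : Set (Model 𝕜)} {w : ℕ}

/-- An inference problem for a model of the class `C`: the model and the evidence. -/
abbrev Query (C : Set (Model 𝕜)) : Type := Σ M : C, (Fin M.1.n → Option Bool)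

/-- The number of variables of the model. -/
abbrev Query.dim (q : Query C) : ℕ := q.1.1.n

/-- The input for inference. -/
abbrev Query.input (q : Query C) : Datum 𝕜 := q.1.1.inferenceInput q.2

/-- The table for the evidence. -/
abbrev Query.table (q : Query C) : List (Entry q.dim) := q.1.1.decomp.table q.2

/-- The probability of the assignment of a table entry. -/
abbrev Query.prob (q : Query C) (E : Entry q.dim) : 𝕜 := q.1.1.dist.prob (completion E.asg)

theorem polyTime_descr :
    PolyTime size Query.dim Query.input fun q : Query C => encodeList q.1.1.descr :=
  .cons_fst (.encodeList _)

theorem polyTime_evidence : PolyTime size Query.dim Query.input fun q : Query C =>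
    encodeList (List.ofFn fun v => encodeValue (q.2 v)) :=
  (PolyTime.cons_snd .cons).snd (.encodeList _)

theorem polyTime_blocks : PolyTime size Query.dim Query.input fun q : Query C =>
    encodeList (q.1.1.decomp.blocks.map encodeBlock) := by
  have h : PolyTime size Query.dim Query.input fun q : Query C =>
      encodeDecomposition q.1.1.decomp :=
    (PolyTime.cons_snd .cons).fst (.encodeList _)
  simpa only [encodeDecomposition_eq] using h

theorem polyBounded_k : PolyBounded Query.dim fun q : Query C => q.1.1.decomp.k :=
  PolyBounded.self.mono fun q => q.1.1.decomp.k_le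

theorem polyTime_base (hz : IsArithmeticSize size) :
    PolyTime size Query.dim Query.input fun q : Query C => .num ((q.1.1.decomp.k + 1 : ℕ) : 𝕜) := by
  have hlen : ∀ q : Query C, (q.1.1.decomp.blocks.map (encodeBlock (𝕜 := 𝕜))).length =
      q.1.1.decomp.k := fun q => by
    rw [List.length_map, Decomposition.blocks, List.length_ofFn]
  have := PolyTime.fold (size := size) (st := fun _ j => .num ((j + 1 : ℕ) : 𝕜)) polyTime_blocks
    (polyBounded_k.mono fun q => (hlen q).le) ?_ (PolyTime.lit .cons 1) ?_
  · simpa only [hlen] using this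
  · refine (PolyBounded.const 1).mono fun q => ?_
    dsimp only
    rw [Fin.getElem_fin, List.getElem_map]
    exact (rootCost_encodeList _).le
  · have hpos : PolyBounded (fun q : Σ q : Query C,
        Fin (q.1.1.decomp.blocks.map (encodeBlock (𝕜 := 𝕜))).length => q.1.dim)
        fun q => (q.2 : ℕ) + 1 :=
      ((polyBounded_k.comap Sigma.fst).add (.const 1)).mono fun q => by
        exact Nat.add_le_add_right (q.2.isLt.le.trans (hlen q.1).le) 1
    have hst := hz.rootBounded_natCast hpos.natSize
    exact ((PolyTime.cons_snd .cons).comp (.cons_fst hst)).natAdd (b := fun _ => 1) hz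
      (.lit .cons 1) (hpos.add (.const 1)).natSize

/-- The probability of a table entry is computable, given the description and the entry. -/
theorem polyTime_prob (hC : EvaluationInPolyTime size C) {κ : Type*} {φ : κ → Query C}
    {c : κ → Datum 𝕜} {E : ∀ k, Entry (φ k).dim}
    (hd : PolyTime size (fun k => (φ k).dim) c fun k => encodeList (φ k).1.1.descr)
    (hE : PolyTime size (fun k => (φ k).dim) c fun k => encodeEntry (E k))
    (hmem : ∀ k, E k ∈ (φ k).table) :
    PolyTime size (fun k => (φ k).dim) c fun k => .num ((φ k).prob (E k)) := by
  obtain ⟨P, p, hP⟩ := hC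
  have h₁ := hE.entry_asg
  simp only [encodeAssignment_completion (Decomposition.asg_eq (hmem _))] at h₁
  exact (hd.cons h₁).comp <| PolyTime.of_runs fun k => hP _ (φ k).1.2 _

/-- Probabilities of table entries have polynomial size, since they are computed in polynomial
time. -/
theorem polyBounded_size_prob (hC : EvaluationInPolyTime size C) :
    PolyBounded (fun a : Σ q : Query C, {E : Entry q.dim // E ∈ q.table} => a.1.dim)
      fun a => size (a.1.prob a.2.1) := by
  have h : PolyTime size (fun a : Σ q : Query C, {E : Entry q.dim // E ∈ q.table} => a.1.dim)
      (fun a => .cons (encodeList a.1.1.1.descr) (encodeEntry a.2.1))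
      fun a => .num (a.1.prob a.2.1) :=
    polyTime_prob (φ := fun a : Σ q : Query C, {E : Entry q.dim // E ∈ q.table} => a.1) hC
      (.cons_fst (.encodeList _)) (.cons_snd .cons) fun a => a.2.2
  exact h.rootBounded

variable [IsStrictOrderedRing 𝕜]

theorem polyTime_table (hz : IsArithmeticSize size)
    (hw : ∀ M ∈ C, M.decomp.width ≤ w) :
    PolyTime size Query.dim Query.input (fun q : Query C => encodeTable q.table) ∧
      PolyTame Query.dim fun q : Query C => q.table := by
  refine PolyTime.table hz (w := w) polyTime_evidence (polyTime_base hz)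
    (polyBounded_k.add (.const 1)) (fun q => Nat.succ_pos _) polyTime_blocks ?_ fun q l hl =>
      (q.1.1.decomp.length_le_width l hl).trans (hw _ q.1.2)
  refine polyBounded_k.mono fun q => ?_
  rw [Decomposition.blocks, List.length_ofFn]

theorem marginalInPolyTime (hz : IsArithmeticSize size)
    (hex : ∀ M ∈ C, M.decomp.IsExchangeable M.dist) (hw : ∀ M ∈ C, M.decomp.width ≤ w)
    (hC : EvaluationInPolyTime size C) : MarginalInPolyTime size C := by
  obtain ⟨hL, hT⟩ := polyTime_table hz hw
  let α : Type := Σ q : Query C, {E : Entry q.dim // E ∈ q.table}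
  -- The summands of the marginal have polynomial size, hence so do all partial sums.
  have hterm : PolyBounded (fun a : α => a.1.dim)
      fun a => size ((a.2.1.cnt : 𝕜) * a.1.prob a.2.1) := by
    have h₁ : PolyBounded (fun a : α => a.1.dim) fun a => size (a.1.prob a.2.1) :=
      polyBounded_size_prob hC
    have h₂ : PolyBounded (fun a : α => a.1.dim) fun a => size (a.2.1.cnt : 𝕜) :=
      hz.rootBounded_natCast ((hT.comap fun a : α => a.1).singleton fun a => a.2.2).cnt_size
    exact ((h₂.add h₁).add (.const 1)).mono fun a => hz.mul_le _ _
  obtain ⟨p, hp⟩ := hterm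
  have hsum : ∀ (q : Query C) (l : List (Entry q.dim)), l.length ≤ q.table.length →
      (∀ E ∈ l, E ∈ q.table) → size ((l.map fun E => (E.cnt : 𝕜) * q.prob E).sum) ≤
        2 * (q.table.length * p.eval q.dim) + 2 := by
    intro q l hl hmem
    refine (hz.sum_le _).trans (Nat.add_le_add_right (Nat.mul_le_mul_left 2 ?_) 2)
    refine (List.sum_le_card_nsmul _ (p.eval q.dim) ?_).trans ?_
    · intro m hm
      rw [List.map_map] at hm
      obtain ⟨E, hE, rfl⟩ := List.mem_map.1 hm
      exact hp ⟨q, E, hmem E hE⟩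
    · rw [List.length_map, List.length_map, smul_eq_mul]
      exact Nat.mul_le_mul_right _ hl
  have hbound : PolyBounded Query.dim fun q : Query C =>
      2 * (q.table.length * p.eval q.dim) + 2 :=
    (((PolyBounded.const 2).mul (hT.length.mul ⟨p, fun q => le_rfl⟩)).add (.const 2))
  let φ : (Σ q : Query C, Stage q.table) → Query C := Sigma.fst
  have hst : RootBounded size (fun s : Σ q : Query C, Stage q.table => s.1.dim) fun s =>
      .num ((s.2.1.1.map fun E => (E.cnt : 𝕜) * s.1.prob E).sum) :=
    (hbound.comap φ).mono fun s =>
      hsum s.1 s.2.1.1 s.2.length_lt.le fun E hE => s.2.mem_of_mem hE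
  have hrun : PolyTime size Query.dim Query.input fun q : Query C =>
      .num (q.table.foldl (fun s E => s + (E.cnt : 𝕜) * q.prob E) 0) := by
    refine PolyTime.foldl (encA := fun _ => encodeEntry) (encS := fun _ => Datum.num) hL hT.length
      .cons (.zero .cons) ?_
    have h₁ := PolyTime.cons_snd (size := size)
      (N := fun s : Σ q : Query C, Stage q.table => s.1.dim) (f := fun s => s.1.input)
      (g := fun s => .cons (.num (s.2.1.1.foldl (fun a E => a + (E.cnt : 𝕜) * s.1.prob E) 0))
        (encodeEntry s.2.1.2)) .cons
    have h₂ := h₁.snd .cons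
    have h₃ := (h₂.entry_cnt hz ((hT.comap φ).singleton fun s => s.2.mem)).mul
      (polyTime_prob hC (φ := φ) (polyTime_descr.lift φ) h₂ fun s => s.2.mem)
      ⟨p, fun s => hp ⟨s.1, s.2.1.2, s.2.mem⟩⟩
    refine (h₁.fst (by simpa only [foldl_add_eq_sum] using hst)).add h₃ ?_
    refine (hbound.comap φ).mono fun s => ?_
    have := hsum s.1 (s.2.1.1 ++ [s.2.1.2]) (by simpa using s.2.length_lt) (by
      simpa [or_imp, forall_and, s.2.mem] using fun E hE => s.2.mem_of_mem hE)
    simpa only [foldl_add_eq_sum, List.map_append, List.sum_append, List.map_cons, List.map_nil,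
      List.sum_cons, List.sum_nil, add_zero] using this
  obtain ⟨P, r, hP⟩ := hrun.exists_runs
  refine ⟨P, r, fun M hM e => ?_⟩
  have := hP ⟨⟨M, hM⟩, e⟩
  rwa [foldl_add_eq_sum, ← (hex M hM).marginal_eq] at this

theorem mpeInPolyTime (hz : IsArithmeticSize size)
    (hex : ∀ M ∈ C, M.decomp.IsExchangeable M.dist) (hw : ∀ M ∈ C, M.decomp.width ≤ w)
    (hC : EvaluationInPolyTime size C) : MPEInPolyTime size C := by
  obtain ⟨hL, hT⟩ := polyTime_table hz hw
  -- The loop keeps the best probability and assignment. Probability `0` and the evidence serve as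
  -- initial state, which is replaced at once as equally good candidates win.
  let step : ∀ q : Query C, 𝕜 × (Fin q.dim → Option Bool) → Entry q.dim →
      𝕜 × (Fin q.dim → Option Bool) :=
    fun q s E => if q.prob E < s.1 then s else (q.prob E, E.asg)
  have hspec : ∀ (q : Query C) (l : List (Entry q.dim)), _ := fun q l =>
    foldl_max_spec (fun E => q.prob E) (fun E => E.asg) (fun E => q.1.1.dist.nonneg _) q.2 l
  let φ : (Σ q : Query C, Stage q.table) → Query C := Sigma.fst
  have hst : RootBounded size (fun s : Σ q : Query C, Stage q.table => s.1.dim) fun s =>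
      .num (s.2.1.1.foldl (step s.1) (0, s.1.2)).1 := by
    obtain ⟨p, hp⟩ := polyBounded_size_prob hC
    refine ⟨p + Polynomial.C (size 0), fun s => ?_⟩
    rw [Polynomial.eval_add, Polynomial.eval_C]
    rcases hspec s.1 s.2.1.1 with ⟨-, h⟩ | ⟨E, hE, h, -⟩
    · simp only [step, h, Datum.rootCost_num]
      omega
    · simp only [step, h, Datum.rootCost_num]
      exact (hp ⟨s.1, E, s.2.mem_of_mem hE⟩).trans (Nat.le_add_right _ _)
  have hrun : PolyTime size Query.dim Query.input fun q : Query C =>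
      .cons (.num (q.table.foldl (step q) (0, q.2)).1)
        (encodeList (List.ofFn fun v => encodeValue ((q.table.foldl (step q) (0, q.2)).2 v))) := by
    refine PolyTime.foldl (encA := fun _ => encodeEntry)
      (σ := fun q : Query C => 𝕜 × (Fin q.dim → Option Bool))
      (encS := fun _ s => .cons (.num s.1) (encodeList (List.ofFn fun v => encodeValue (s.2 v))))
      (step := step) (init := fun q => (0, q.2)) hL hT.length
      .cons (.cons (.zero .cons) polyTime_evidence) ?_
    have h₁ := PolyTime.cons_snd (size := size)
      (N := fun s : Σ q : Query C, Stage q.table => s.1.dim) (f := fun s => s.1.input)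
      (g := fun s => .cons (.cons (.num (s.2.1.1.foldl (step s.1) (0, s.1.2)).1)
        (encodeList (List.ofFn fun v =>
          encodeValue ((s.2.1.1.foldl (step s.1) (0, s.1.2)).2 v))))
        (encodeEntry s.2.1.2)) .cons
    have h₂ := h₁.snd .cons
    have h₃ := h₁.fst .cons
    have h₄ := polyTime_prob hC (φ := φ) (polyTime_descr.lift φ) h₂ fun s => s.2.mem
    refine PolyTime.ite_lt (p := fun s : Σ q : Query C, Stage q.table =>
      s.1.prob s.2.1.2 < (s.2.1.1.foldl (step s.1) (0, s.1.2)).1) h₄ (h₃.fst hst)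
      (fun s => Iff.rfl) ?_ ?_
    · have h₅ := h₃.comap (Subtype.val : {s : Σ q : Query C, Stage q.table //
        s.1.prob s.2.1.2 < (s.2.1.1.foldl (step s.1) (0, s.1.2)).1} → _)
      refine Eq.mp ?_ h₅
      congr 1
      funext s
      have : step s.1.1 (s.1.2.1.1.foldl (step s.1.1) (0, s.1.1.2)) s.1.2.1.2 =
        s.1.2.1.1.foldl (step s.1.1) (0, s.1.1.2) := if_pos s.2
      rw [this]
    · have h₅ := (h₄.cons h₂.entry_asg).comap (Subtype.val : {s : Σ q : Query C, Stage q.table //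
        ¬ s.1.prob s.2.1.2 < (s.2.1.1.foldl (step s.1) (0, s.1.2)).1} → _)
      refine Eq.mp ?_ h₅
      congr 1
      funext s
      have : step s.1.1 (s.1.2.1.1.foldl (step s.1.1) (0, s.1.1.2)) s.1.2.1.2 =
        (s.1.1.prob s.1.2.1.2, s.1.2.1.2.asg) := if_neg s.2
      rw [this]
  obtain ⟨P, r, hP⟩ := (hrun.snd (.encodeList _)).exists_runs
  refine ⟨P, r, fun M hM e => ?_⟩
  let q : Query C := ⟨⟨M, hM⟩, e⟩
  obtain ⟨t, ht, hr⟩ := hP q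
  have hne : q.table ≠ [] := by
    obtain ⟨E, hE, -⟩ := (hex M hM).exists_mem_table (e := e) (x := completion e)
      fun v b hv => by simp [completion, hv]
    exact List.ne_nil_of_mem hE
  rcases hspec q q.table with ⟨h, -⟩ | ⟨E, hE, h, hmax⟩
  · exact absurd h hne
  · refine ⟨t, ht, completion E.asg, ⟨Decomposition.extends_completion hE, fun y hy => ?_⟩, ?_⟩
    · obtain ⟨E', hE', hy'⟩ := (hex M hM).exists_mem_table hy
      rw [← hy']
      exact hmax E' hE'
    · rw [← encodeAssignment_completion (Decomposition.asg_eq hE)]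
      have : q.table.foldl (step q) (0, q.2) = (q.prob E, E.asg) := h
      rw [this] at hr
      exact hr

end Inference

end Exch

theorem mainTheorem1 (w : ℕ) :
    (∀ C : Set (Exch.Model ℚ),
      (∀ M ∈ C, M.decomp.IsExchangeable M.dist ∧ M.decomp.width ≤ w) →
      Exch.EvaluationInPolyTime Exch.bitSize C →
        Exch.MPEInPolyTime Exch.bitSize C ∧ Exch.MarginalInPolyTime Exch.bitSize C) ∧
    (∀ C : Set (Exch.Model ℝ),
      (∀ M ∈ C, M.decomp.IsExchangeable M.dist ∧ M.decomp.width ≤ w) →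
      Exch.EvaluationInPolyTime Exch.unitSize C →
        Exch.MPEInPolyTime Exch.unitSize C ∧ Exch.MarginalInPolyTime Exch.unitSize C) :=
  ⟨fun _ h hC =>
    ⟨Exch.mpeInPolyTime Exch.isArithmeticSize_bitSize (fun M hM => (h M hM).1)
        (fun M hM => (h M hM).2) hC,
      Exch.marginalInPolyTime Exch.isArithmeticSize_bitSize (fun M hM => (h M hM).1)
        (fun M hM => (h M hM).2) hC⟩,
    fun _ h hC =>
    ⟨Exch.mpeInPolyTime Exch.isArithmeticSize_unitSize (fun M hM => (h M hM).1)
        (fun M hM => (h M hM).2) hC,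
      Exch.marginalInPolyTime Exch.isArithmeticSize_unitSize (fun M hM => (h M hM).1)
        (fun M hM => (h M hM).2) hC⟩⟩
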